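/- Fix an alphabet $\Sigma$ (finite or infinite). **Automata.** A lo-set $U$ is a finite totally ordered set labelled by $\Sigma$; a lo-set with interfaces (ilo-set) is a lo-set $U$ with subsets $S_U,T_U\subseteq U$. A coface map $d_{A,B}:U\to V$ of lo-sets consists of an order- and label-preserving injection $U\hookrightarrow V$ and a partition of the complement of its image into two sets $A$ and $B$ (the events unstarted, respectively terminated, in $U$); composition is $d_{C,D}\circ d_{A,B}=d_{g(A)\cup C,\,g(B)\cup D}$, where $g$ is the injection of $d_{C,D}$. For ilo-sets one requires in addition $A\cap S_V=\emptyset=B\cap T_V$ and that $S_U,T_U$ are the preimages of $S_V,T_V$. Up to isomorphism of objects this gives small categories $\square$ and $\mathrm{I}\square$. A *higher-dimensional automaton* (HDA) is a presheaf $X$ on $\square$ with finitely many cells (elements of the sets $X[U]$) and with sets $X_\bot$ of start cells and $X^\top$ of accept cells; an HDA with interfaces (iHDA) is likewise a presheaf on $\mathrm{I}\square$ with finitely many cells and sets of start and accept cells such that $S_U=U$ for start cells in $X[U]$ and $T_U=U$ for accept cells in $X[U]$. **Ipomsets.** A labelled iposet $P$ is a finite $\Sigma$-labelled set with two strict partial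 orders $<$ (precedence) and $\dashrightarrow$ (event order) such that any two distinct elements are comparable by at least one of them, and with subsets $S_P$ of $<$-minimal and $T_P$ of $<$-maximal elements (interfaces). A subsumption $P\to Q$ is a label-preserving bijection $f$ with $f(S_P)=S_Q$ and $f(T_P)=T_Q$ such that $f(x)<f(y)$ implies $x<y$, and such that $x\dashrightarrow y$ with $x,y$ $<$-incomparable implies $f(x)\dashrightarrow f(y)$; it is an isomorphism if moreover $x<y$ implies $f(x)<f(y)$. An ipomset is an isomorphism class of labelled iposets; $P\sqsubseteq Q$ means that there is a subsumption $P\to Q$. $P$ is interval if there are $b,e:P\to\mathbb{R}$ with $b\le e$ and $x<y\iff e(x)<b(y)$. If $T_P\cong S_Q$ as lo-sets, $P*Q$ is the disjoint union of $P$ and $Q$ with $T_P$ and $S_Q$ identified along the unique isomorphism, with $S_{P*Q}=S_P$, $T_{P*Q}=T_Q$, event order the transitive closure of those of $P$ and $Q$, and $x<y$ iff $x<_Py$ or $x<_Qy$ or ($x\in P\setminus T_P$ and $y\in Q\setminus S_Q$). **Languages.** A language is a set $L$ of interval ipomsets such that $Q\in L$, $P\sqsubseteq Q$ and $P$ interval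 imply $P\in L$. Put $L*M=\{R \text{ interval}\mid R\sqsubseteq P*Q \text{ for some } P\in L,\ Q\in M \text{ with } T_P\cong S_Q\}$, $L^1=L$, $L^{n+1}=L*L^n$ and $L^+=\bigcup_{n\ge1}L^n$. $L$ is *separated* if every $P\in L$ has an element outside $S_P\cup T_P$. **Recognition.** A path in an HDA or iHDA is a finite sequence of cells, each consecutive pair $(x,y)$ of which is either an up-step, $x=X[d_{A,\emptyset}](y)$, or a down-step, $y=X[d_{\emptyset,B}](x)$. Its ipomset is the gluing composition of the ipomsets of its steps, an up-step to a cell with events $U$ contributing the discrete ipomset $U$ with interfaces $(U\setminus A,U)$, a down-step from a cell with events $U$ contributing the discrete ipomset $U$ with interfaces $(U,U\setminus B)$, and a path of length $0$ at a cell with events $U$ having the ipomset $U$ with interfaces $(U,U)$. The language of an HDA or iHDA is the set of ipomsets of its paths from a start cell to an accept cell. A language is *regular* if it is recognised by an HDA or by an iHDA. **Proposition.** Let $L$ be a separated language that is regular, that is, the language of an HDA or of an iHDA. Then the Kleene plus $L^+$ is regular; more precisely, it is the language of an HDA, and also the language of an iHDA. -/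

import Mathlib

open CategoryTheory Opposite

namespace HigherDim

universe u v w w'

/-! ### Lo-sets, ilo-sets and the labelled precube categories

The objects of the (skeletal) precube categories are words; the lo-set of a word of length `n` is
`Fin n` with its usual order (the event order) and the labelling given by the letters. -/

/-- A lo-set up to isomorphism, that is, a word over the alphabet `Act`. -/
structure LoSet (Act : Type u) where
  n : ℕ
  lab : Fin n → Act

/-- A lo-set with a source interface `S` and a target interface `T`, up to isomorphism. -/
structure ILoSet (Act : Type u) extends LoSet Act where
  S : Set (Fin n)
  T : Set (Fin n)

variable {Act : Type u}

/-- The coface map `d_{A,B} : U → V`: it inserts the events of `A` (which are unstarted in `U`)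
and of `B` (which are terminated in `U`). -/
@[ext]
structure Coface (U V : LoSet Act) where
  emb : Fin U.n ↪o Fin V.n
  A : Set (Fin V.n)
  B : Set (Fin V.n)
  lab : ∀ i, V.lab (emb i) = U.lab i
  disj : Disjoint A B
  union : A ∪ B = (Set.range emb)ᶜ

/-- Coface maps of ilo-sets: events of the source interface of `V` cannot be unstarted, those of the
target interface cannot be terminated, and the interfaces of `U` are the preimages of those of
`V`. -/
@[ext]
structure ICoface (U V : ILoSet Act) extends Coface U.toLoSet V.toLoSet where
  A_S : Disjoint A V.S
  B_T : Disjoint B V.T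
  S_eq : U.S = emb ⁻¹' V.S
  T_eq : U.T = emb ⁻¹' V.T

namespace Coface

/-- The identity coface map `d_{∅,∅}`. -/
def id (U : LoSet Act) : Coface U U where
  emb := RelEmbedding.refl _
  A := ∅
  B := ∅
  lab _ := rfl
  disj := by simp
  union := by
    ext i
    simp

/-- The composite `d_{C,D} ∘ d_{A,B}`, in diagrammatic order. -/
def comp {U V W : LoSet Act} (d : Coface U V) (e : Coface V W) : Coface U W where
  emb := d.emb.trans e.emb
  A := e.emb '' d.A ∪ e.A
  B := e.emb '' d.B ∪ e.B
  lab i := by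
    rw [RelEmbedding.trans_apply, e.lab, d.lab]
  disj := by
    have hA : e.A ⊆ (Set.range e.emb)ᶜ := e.union ▸ Set.subset_union_left
    have hB : e.B ⊆ (Set.range e.emb)ᶜ := e.union ▸ Set.subset_union_right
    rw [Set.disjoint_left]
    rintro x (⟨a, ha, rfl⟩ | hx) (⟨b, hb, hab⟩ | hx')
    · rw [e.emb.injective hab] at hb
      exact Set.disjoint_left.1 d.disj ha hb
    · exact hB hx' ⟨a, rfl⟩
    · exact hA hx ⟨b, hab⟩
    · exact Set.disjoint_left.1 e.disj hx hx'
  union := by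
    have he : ∀ x, (x ∈ e.A ∨ x ∈ e.B) ↔ ¬ ∃ y, e.emb y = x := fun x => by
      have h := Set.ext_iff.1 e.union x
      simpa using h
    have hd : ∀ x, (x ∈ d.A ∨ x ∈ d.B) ↔ ¬ ∃ y, d.emb y = x := fun x => by
      have h := Set.ext_iff.1 d.union x
      simpa using h
    ext x
    simp only [Set.mem_union, Set.mem_image, Set.mem_compl_iff, Set.mem_range,
      RelEmbedding.trans_apply]
    constructor
    · rintro ((⟨a, ha, rfl⟩ | h) | (⟨a, ha, rfl⟩ | h)) ⟨y, hy⟩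
      · exact (hd a).1 (Or.inl ha) ⟨y, e.emb.injective hy⟩
      · exact (he x).1 (Or.inl h) ⟨_, hy⟩
      · exact (hd a).1 (Or.inr ha) ⟨y, e.emb.injective hy⟩
      · exact (he x).1 (Or.inr h) ⟨_, hy⟩
    · intro h
      by_cases hx : ∃ y, e.emb y = x
      · obtain ⟨y, rfl⟩ := hx
        have : ¬ ∃ z, d.emb z = y := by
          rintro ⟨z, rfl⟩
          exact h ⟨z, rfl⟩
        rcases (hd y).2 this with h1 | h1
        · exact Or.inl (Or.inl ⟨y, h1, rfl⟩)
        · exact Or.inr (Or.inl ⟨y, h1, rfl⟩)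
      · rcases (he x).2 hx with h1 | h1
        · exact Or.inl (Or.inr h1)
        · exact Or.inr (Or.inr h1)

end Coface

namespace ICoface

/-- The identity coface map of an ilo-set. -/
def id (U : ILoSet Act) : ICoface U U where
  toCoface := Coface.id U.toLoSet
  A_S := Set.disjoint_left.2 fun _ h => h.elim
  B_T := Set.disjoint_left.2 fun _ h => h.elim
  S_eq := rfl
  T_eq := rfl

/-- Composition of coface maps of ilo-sets, in diagrammatic order. -/
def comp {U V W : ILoSet Act} (d : ICoface U V) (e : ICoface V W) : ICoface U W where
  toCoface := d.toCoface.comp e.toCoface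
  A_S := by
    rw [Set.disjoint_left]
    rintro x (⟨a, ha, rfl⟩ | hx) h
    · refine Set.disjoint_left.1 d.A_S ha ?_
      rw [e.S_eq]
      exact h
    · exact Set.disjoint_left.1 e.A_S hx h
  B_T := by
    rw [Set.disjoint_left]
    rintro x (⟨a, ha, rfl⟩ | hx) h
    · refine Set.disjoint_left.1 d.B_T ha ?_
      rw [e.T_eq]
      exact h
    · exact Set.disjoint_left.1 e.B_T hx h
  S_eq := by
    rw [d.S_eq, e.S_eq]
    rfl
  T_eq := by
    rw [d.T_eq, e.T_eq]
    rfl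

end ICoface

theorem Coface.id_comp {U V : LoSet Act} (f : Coface U V) : (Coface.id U).comp f = f := by
  apply Coface.ext
  · rfl
  · simp [Coface.comp, Coface.id]
  · simp [Coface.comp, Coface.id]

theorem Coface.comp_id {U V : LoSet Act} (f : Coface U V) : f.comp (Coface.id V) = f := by
  apply Coface.ext
  · rfl
  · simp [Coface.comp, Coface.id]
  · simp [Coface.comp, Coface.id]

theorem Coface.assoc {U V W Z : LoSet Act} (f : Coface U V) (g : Coface V W) (h : Coface W Z) :
    (f.comp g).comp h = f.comp (g.comp h) := by
  apply Coface.ext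
  · rfl
  · simp [Coface.comp, Set.image_union, Set.image_image, Set.union_assoc]
  · simp [Coface.comp, Set.image_union, Set.image_image, Set.union_assoc]

/-- The labelled precube category. -/
instance : Category.{0} (LoSet Act) where
  Hom := Coface
  id := Coface.id
  comp := Coface.comp
  id_comp := Coface.id_comp
  comp_id := Coface.comp_id
  assoc := Coface.assoc

theorem ICoface.toCoface_injective {U V : ILoSet Act} :
    Function.Injective (ICoface.toCoface : ICoface U V → Coface U.toLoSet V.toLoSet) := by
  rintro ⟨d, _, _, _, _⟩ ⟨e, _, _, _, _⟩ h
  cases h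
  rfl

/-- The labelled precube category with interfaces. -/
instance : Category.{0} (ILoSet Act) where
  Hom := ICoface
  id := ICoface.id
  comp := ICoface.comp
  id_comp f := ICoface.toCoface_injective (Coface.id_comp f.toCoface)
  comp_id f := ICoface.toCoface_injective (Coface.comp_id f.toCoface)
  assoc f g h := ICoface.toCoface_injective (Coface.assoc f.toCoface g.toCoface h.toCoface)

/-- The functor forgetting interfaces. -/
def forgetInterfaces (Act : Type u) : ILoSet Act ⥤ LoSet Act where
  obj U := U.toLoSet
  map f := ICoface.toCoface f
  map_id _ := rfl
  map_comp _ _ := rfl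

/-! ### Labelled iposets and ipomsets -/

/-- A labelled iposet `(P, <, ⇢, S, T, λ)`; `prec` is the precedence order `<` and `evo` the event
order `⇢`. -/
structure IPoset (Act : Type u) where
  carrier : Type
  finite : Finite carrier
  prec : carrier → carrier → Prop
  evo : carrier → carrier → Prop
  S : Set carrier
  T : Set carrier
  lab : carrier → Act
  prec_irrefl : ∀ x, ¬ prec x x
  prec_trans : ∀ x y z, prec x y → prec y z → prec x z
  evo_irrefl : ∀ x, ¬ evo x x
  evo_trans : ∀ x y z, evo x y → evo y z → evo x z
  comparable : ∀ x y, x = y ∨ prec x y ∨ prec y x ∨ evo x y ∨ evo y x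
  S_minimal : ∀ x ∈ S, ∀ y, ¬ prec y x
  T_maximal : ∀ x ∈ T, ∀ y, ¬ prec x y

namespace IPoset

/-- A subsumption `P → Q`. -/
structure Subsumption (P Q : IPoset Act) where
  toEquiv : P.carrier ≃ Q.carrier
  map_S : toEquiv '' P.S = Q.S
  map_T : toEquiv '' P.T = Q.T
  map_lab : ∀ x, Q.lab (toEquiv x) = P.lab x
  reflect_prec : ∀ x y, Q.prec (toEquiv x) (toEquiv y) → P.prec x y
  map_evo : ∀ x y, P.evo x y → ¬ P.prec x y → ¬ P.prec y x → Q.evo (toEquiv x) (toEquiv y)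

/-- An isomorphism: a subsumption that is an isomorphism of precedence orders. (The event order is
only relevant between elements that are incomparable for the precedence order.) -/
structure Iso (P Q : IPoset Act) extends Subsumption P Q where
  map_prec : ∀ x y, P.prec x y → Q.prec (toEquiv x) (toEquiv y)

/-- The identity subsumption. -/
def Subsumption.refl (P : IPoset Act) : Subsumption P P where
  toEquiv := Equiv.refl _
  map_S := by simp
  map_T := by simp
  map_lab _ := rfl
  reflect_prec _ _ h := h
  map_evo _ _ h _ _ := h

/-- Composition of subsumptions. -/
def Subsumption.trans {P Q R : IPoset Act} (f : Subsumption P Q) (g : Subsumption Q R) :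
    Subsumption P R where
  toEquiv := f.toEquiv.trans g.toEquiv
  map_S := by
    rw [← g.map_S, ← f.map_S, Set.image_image]
    rfl
  map_T := by
    rw [← g.map_T, ← f.map_T, Set.image_image]
    rfl
  map_lab x := (g.map_lab _).trans (f.map_lab x)
  reflect_prec x y h := f.reflect_prec x y (g.reflect_prec _ _ h)
  map_evo x y h h1 h2 := g.map_evo _ _ (f.map_evo x y h h1 h2)
    (fun h3 => h1 (f.reflect_prec _ _ h3)) (fun h3 => h2 (f.reflect_prec _ _ h3))

/-- The inverse of an isomorphism. -/
def Iso.symm {P Q : IPoset Act} (f : Iso P Q) : Iso Q P where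
  toEquiv := f.toEquiv.symm
  map_S := by
    rw [← f.map_S, Equiv.symm_image_image]
  map_T := by
    rw [← f.map_T, Equiv.symm_image_image]
  map_lab x := by
    rw [← f.map_lab, Equiv.apply_symm_apply]
  reflect_prec x y h := by
    have := f.map_prec _ _ h
    rwa [Equiv.apply_symm_apply, Equiv.apply_symm_apply] at this
  map_prec x y h := by
    apply f.reflect_prec
    rwa [Equiv.apply_symm_apply, Equiv.apply_symm_apply]
  map_evo x y h h1 h2 := by
    obtain ⟨x, rfl⟩ := f.toEquiv.surjective x
    obtain ⟨y, rfl⟩ := f.toEquiv.surjective y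
    rw [Equiv.symm_apply_apply, Equiv.symm_apply_apply]
    have h1' : ¬ P.prec x y := fun h' => h1 (f.map_prec _ _ h')
    have h2' : ¬ P.prec y x := fun h' => h2 (f.map_prec _ _ h')
    rcases P.comparable x y with rfl | h3 | h3 | h3 | h3
    · exact absurd h (Q.evo_irrefl _)
    · exact absurd h3 h1'
    · exact absurd h3 h2'
    · exact h3
    · exact absurd (Q.evo_trans _ _ _ h (f.map_evo _ _ h3 h2' h1')) (Q.evo_irrefl _)

/-- Isomorphism of labelled iposets as a setoid. -/
instance setoid (Act : Type u) : Setoid (IPoset Act) where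
  r P Q := Nonempty (Iso P Q)
  iseqv :=
    { refl := fun P => ⟨{ Subsumption.refl P with map_prec := fun _ _ h => h }⟩
      symm := fun ⟨f⟩ => ⟨f.symm⟩
      trans := fun ⟨f⟩ ⟨g⟩ => ⟨{ f.toSubsumption.trans g.toSubsumption with
        map_prec := fun x y h => g.map_prec _ _ (f.map_prec x y h) }⟩ }

/-- `P` admits an interval representation. -/
def IsInterval (P : IPoset Act) : Prop :=
  ∃ b e : P.carrier → ℝ, (∀ x, b x ≤ e x) ∧ ∀ x y, P.prec x y ↔ e x < b y

/-- `P` is separated: some element lies in no interface. -/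
def IsSeparated (P : IPoset Act) : Prop :=
  (Set.univ \ (P.S ∪ P.T)).Nonempty

/-- An isomorphism of lo-sets from the target interface of `P` to the source interface of `Q`. -/
structure InterfaceIso (P Q : IPoset Act) where
  toEquiv : P.T ≃ Q.S
  evo_iff : ∀ x y : P.T, P.evo x y ↔ Q.evo (toEquiv x) (toEquiv y)
  lab_eq : ∀ x : P.T, Q.lab (toEquiv x) = P.lab x

section Glue

variable (P Q : IPoset Act) (f : InterfaceIso P Q)

/-- The carrier of the gluing composition: the disjoint union of `P` and `Q` with `x ∈ T_P`
identified with `f x ∈ S_Q`, represented as the disjoint union of `P` and `Q \ S_Q`. -/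
abbrev GlueCarrier : Type := P.carrier ⊕ {q : Q.carrier // q ∉ Q.S}

variable {P Q}

/-- The structural inclusion of the left factor. -/
def glueLeft (x : P.carrier) : GlueCarrier P Q := Sum.inl x

open Classical in
/-- The structural inclusion of the right factor. -/
noncomputable def glueRight (y : Q.carrier) : GlueCarrier P Q :=
  if h : y ∈ Q.S then Sum.inl (f.toEquiv.symm ⟨y, h⟩ : P.T).1 else Sum.inr ⟨y, h⟩

/-- The precedence order of the gluing composition. -/
def gluePrec (a b : GlueCarrier P Q) : Prop :=
  (∃ x y, a = glueLeft x ∧ b = glueLeft y ∧ P.prec x y) ∨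
  (∃ x y, a = glueRight f x ∧ b = glueRight f y ∧ Q.prec x y) ∨
  (∃ x y, a = glueLeft x ∧ b = glueRight f y ∧ x ∉ P.T ∧ y ∉ Q.S)

/-- The union of the event orders of the factors. -/
def glueEvoStep (a b : GlueCarrier P Q) : Prop :=
  (∃ x y, a = glueLeft x ∧ b = glueLeft y ∧ P.evo x y) ∨
  (∃ x y, a = glueRight f x ∧ b = glueRight f y ∧ Q.evo x y)

variable {f}

theorem glueLeft_inj {x y : P.carrier} :
    (glueLeft x : GlueCarrier P Q) = glueLeft y ↔ x = y := by
  simp [glueLeft]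

theorem glueLeft_eq_glueRight {x : P.carrier} {y : Q.carrier} :
    glueLeft x = glueRight f y ↔ ∃ t : P.T, x = t ∧ y = f.toEquiv t := by
  unfold glueLeft glueRight
  split_ifs with h
  · constructor
    · intro hx
      exact ⟨f.toEquiv.symm ⟨y, h⟩, Sum.inl.inj hx, by simp⟩
    · rintro ⟨t, rfl, rfl⟩
      simp
  · constructor
    · intro hx
      cases hx
    · rintro ⟨t, rfl, rfl⟩
      exact absurd (f.toEquiv t).2 h

theorem glueRight_inj {x y : Q.carrier} : glueRight f x = glueRight f y ↔ x = y := by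
  constructor
  · intro h
    by_cases hx : x ∈ Q.S
    · have h1 : glueLeft (f.toEquiv.symm ⟨x, hx⟩ : P.T).1 = glueRight f x :=
        glueLeft_eq_glueRight.2 ⟨_, rfl, by simp⟩
      rw [h, glueLeft_eq_glueRight] at h1
      obtain ⟨t, h2, rfl⟩ := h1
      rw [← Subtype.ext h2]
      simp
    · by_cases hy : y ∈ Q.S
      · simp [glueRight, hx, hy] at h
      · simpa [glueRight, hx, hy] using h
  · rintro rfl
    rfl

theorem exists_glueLeft_or_glueRight (a : GlueCarrier P Q) :
    (∃ x, a = glueLeft x) ∨ (∃ y, y ∉ Q.S ∧ a = glueRight f y) := by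
  rcases a with x | ⟨y, hy⟩
  · exact Or.inl ⟨x, rfl⟩
  · exact Or.inr ⟨y, hy, by simp [glueRight, hy]⟩

theorem glueEvo_cases {a b : GlueCarrier P Q} (h : Relation.TransGen (glueEvoStep f) a b) :
    (∃ x y, a = glueLeft x ∧ b = glueLeft y ∧ P.evo x y) ∨
    (∃ x y, a = glueRight f x ∧ b = glueRight f y ∧ Q.evo x y) ∨
    (∃ (x : P.carrier) (t : P.T) (y : Q.carrier), a = glueLeft x ∧ b = glueRight f y ∧
      P.evo x t ∧ Q.evo (f.toEquiv t) y) ∨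
    (∃ (x : Q.carrier) (t : P.T) (y : P.carrier), a = glueRight f x ∧ b = glueLeft y ∧
      Q.evo x (f.toEquiv t) ∧ P.evo t y) := by
  induction h with
  | single h =>
    rcases h with h | h
    · exact Or.inl h
    · exact Or.inr (Or.inl h)
  | tail _ h ih =>
    rcases ih with ⟨x, y, rfl, rfl, hxy⟩ | ⟨x, y, rfl, rfl, hxy⟩ | ⟨x, t, y, rfl, rfl, h1, h2⟩ |
        ⟨x, t, y, rfl, rfl, h1, h2⟩ <;>
      rcases h with ⟨y', z, hy, rfl, h3⟩ | ⟨y', z, hy, rfl, h3⟩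
    · rw [glueLeft_inj] at hy
      subst hy
      exact Or.inl ⟨x, z, rfl, rfl, P.evo_trans _ _ _ hxy h3⟩
    · obtain ⟨t, rfl, rfl⟩ := glueLeft_eq_glueRight.1 hy
      exact Or.inr (Or.inr (Or.inl ⟨x, t, z, rfl, rfl, hxy, h3⟩))
    · obtain ⟨t, rfl, rfl⟩ := glueLeft_eq_glueRight.1 hy.symm
      exact Or.inr (Or.inr (Or.inr ⟨x, t, z, rfl, rfl, hxy, h3⟩))
    · rw [glueRight_inj] at hy
      subst hy
      exact Or.inr (Or.inl ⟨x, z, rfl, rfl, Q.evo_trans _ _ _ hxy h3⟩)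
    · obtain ⟨s, rfl, rfl⟩ := glueLeft_eq_glueRight.1 hy.symm
      exact Or.inl ⟨x, z, rfl, rfl, P.evo_trans _ _ _ h1
        (P.evo_trans _ _ _ ((f.evo_iff _ _).2 h2) h3)⟩
    · rw [glueRight_inj] at hy
      subst hy
      exact Or.inr (Or.inr (Or.inl ⟨x, t, z, rfl, rfl, h1, Q.evo_trans _ _ _ h2 h3⟩))
    · rw [glueLeft_inj] at hy
      subst hy
      exact Or.inr (Or.inr (Or.inr ⟨x, t, z, rfl, rfl, h1, P.evo_trans _ _ _ h2 h3⟩))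
    · obtain ⟨s, rfl, rfl⟩ := glueLeft_eq_glueRight.1 hy
      exact Or.inr (Or.inl ⟨x, z, rfl, rfl, Q.evo_trans _ _ _ h1
        (Q.evo_trans _ _ _ ((f.evo_iff _ _).1 h2) h3)⟩)

theorem glueEvo_irrefl (a : GlueCarrier P Q) : ¬ Relation.TransGen (glueEvoStep f) a a := by
  intro h
  rcases glueEvo_cases h with ⟨x, y, rfl, h0, hxy⟩ | ⟨x, y, rfl, h0, hxy⟩ |
    ⟨x, t, y, rfl, h0, h1, h2⟩ | ⟨x, t, y, rfl, h0, h1, h2⟩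
  · rw [glueLeft_inj] at h0
    subst h0
    exact P.evo_irrefl _ hxy
  · rw [glueRight_inj] at h0
    subst h0
    exact Q.evo_irrefl _ hxy
  · obtain ⟨s, rfl, rfl⟩ := glueLeft_eq_glueRight.1 h0
    exact P.evo_irrefl _ (P.evo_trans _ _ _ h1 ((f.evo_iff _ _).2 h2))
  · obtain ⟨s, rfl, rfl⟩ := glueLeft_eq_glueRight.1 h0.symm
    exact P.evo_irrefl _ (P.evo_trans _ _ _ h2 ((f.evo_iff _ _).2 h1))

theorem gluePrec_irrefl (a : GlueCarrier P Q) : ¬ gluePrec f a a := by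
  rintro (⟨x, y, rfl, h0, h⟩ | ⟨x, y, rfl, h0, h⟩ | ⟨x, y, rfl, h0, h1, h2⟩)
  · rw [glueLeft_inj] at h0
    subst h0
    exact P.prec_irrefl _ h
  · rw [glueRight_inj] at h0
    subst h0
    exact Q.prec_irrefl _ h
  · obtain ⟨s, rfl, rfl⟩ := glueLeft_eq_glueRight.1 h0
    exact h1 s.2

theorem gluePrec_trans {a b c : GlueCarrier P Q} (h : gluePrec f a b) (h' : gluePrec f b c) :
    gluePrec f a c := by
  rcases h with ⟨x, y, rfl, rfl, h⟩ | ⟨x, y, rfl, rfl, h⟩ | ⟨x, y, rfl, rfl, h1, h2⟩ <;>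
    rcases h' with ⟨y', z, hy, rfl, h'⟩ | ⟨y', z, hy, rfl, h'⟩ | ⟨y', z, hy, rfl, h1', h2'⟩
  · rw [glueLeft_inj] at hy
    subst hy
    exact Or.inl ⟨x, z, rfl, rfl, P.prec_trans _ _ _ h h'⟩
  · obtain ⟨t, rfl, rfl⟩ := glueLeft_eq_glueRight.1 hy
    exact Or.inr (Or.inr ⟨x, z, rfl, rfl, fun hx => P.T_maximal _ hx _ h,
      fun hz => Q.S_minimal _ hz _ h'⟩)
  · exact Or.inr (Or.inr ⟨x, z, rfl, rfl, fun hx => P.T_maximal _ hx _ h, h2'⟩)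
  · obtain ⟨t, rfl, rfl⟩ := glueLeft_eq_glueRight.1 hy.symm
    exact absurd h' (P.T_maximal _ t.2 _)
  · rw [glueRight_inj] at hy
    subst hy
    exact Or.inr (Or.inl ⟨x, z, rfl, rfl, Q.prec_trans _ _ _ h h'⟩)
  · obtain ⟨t, rfl, rfl⟩ := glueLeft_eq_glueRight.1 hy.symm
    exact absurd t.2 h1'
  · obtain ⟨t, rfl, rfl⟩ := glueLeft_eq_glueRight.1 hy.symm
    exact absurd (f.toEquiv t).2 h2
  · rw [glueRight_inj] at hy
    subst hy
    exact Or.inr (Or.inr ⟨x, z, rfl, rfl, h1, fun hz => Q.S_minimal _ hz _ h'⟩)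
  · obtain ⟨t, rfl, rfl⟩ := glueLeft_eq_glueRight.1 hy.symm
    exact absurd t.2 h1'

theorem glue_comparable_mixed (x : P.carrier) (y : Q.carrier) (hy : y ∉ Q.S) :
    gluePrec f (glueLeft x) (glueRight f y) ∨
    gluePrec f (glueRight f y) (glueLeft x) ∨
    Relation.TransGen (glueEvoStep f) (glueLeft x) (glueRight f y) ∨
    Relation.TransGen (glueEvoStep f) (glueRight f y) (glueLeft x) := by
  by_cases hx : x ∈ P.T
  · have hx' : glueLeft x = glueRight f (f.toEquiv ⟨x, hx⟩ : Q.S).1 :=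
      glueLeft_eq_glueRight.2 ⟨⟨x, hx⟩, rfl, rfl⟩
    rw [hx']
    rcases Q.comparable (f.toEquiv ⟨x, hx⟩ : Q.S).1 y with h | h | h | h | h
    · exact absurd (h ▸ (f.toEquiv ⟨x, hx⟩ : Q.S).2) hy
    · exact Or.inl (Or.inr (Or.inl ⟨_, _, rfl, rfl, h⟩))
    · exact Or.inr (Or.inl (Or.inr (Or.inl ⟨_, _, rfl, rfl, h⟩)))
    · exact Or.inr (Or.inr (Or.inl (.single (Or.inr ⟨_, _, rfl, rfl, h⟩))))
    · exact Or.inr (Or.inr (Or.inr (.single (Or.inr ⟨_, _, rfl, rfl, h⟩))))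
  · exact Or.inl (Or.inr (Or.inr ⟨x, y, rfl, rfl, hx, hy⟩))

theorem glue_comparable (a b : GlueCarrier P Q) :
    a = b ∨ gluePrec f a b ∨ gluePrec f b a ∨
      Relation.TransGen (glueEvoStep f) a b ∨ Relation.TransGen (glueEvoStep f) b a := by
  rcases exists_glueLeft_or_glueRight (f := f) a with ⟨x, rfl⟩ | ⟨x, hx, rfl⟩ <;>
    rcases exists_glueLeft_or_glueRight (f := f) b with ⟨y, rfl⟩ | ⟨y, hy, rfl⟩
  · rcases P.comparable x y with rfl | h | h | h | h
    · exact Or.inl rfl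
    · exact Or.inr (Or.inl (Or.inl ⟨_, _, rfl, rfl, h⟩))
    · exact Or.inr (Or.inr (Or.inl (Or.inl ⟨_, _, rfl, rfl, h⟩)))
    · exact Or.inr (Or.inr (Or.inr (Or.inl (.single (Or.inl ⟨_, _, rfl, rfl, h⟩)))))
    · exact Or.inr (Or.inr (Or.inr (Or.inr (.single (Or.inl ⟨_, _, rfl, rfl, h⟩)))))
  · exact Or.inr (glue_comparable_mixed x y hy)
  · have := glue_comparable_mixed (f := f) y x hx
    tauto
  · rcases Q.comparable x y with rfl | h | h | h | h
    · exact Or.inl rfl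
    · exact Or.inr (Or.inl (Or.inr (Or.inl ⟨_, _, rfl, rfl, h⟩)))
    · exact Or.inr (Or.inr (Or.inl (Or.inr (Or.inl ⟨_, _, rfl, rfl, h⟩))))
    · exact Or.inr (Or.inr (Or.inr (Or.inl (.single (Or.inr ⟨_, _, rfl, rfl, h⟩)))))
    · exact Or.inr (Or.inr (Or.inr (Or.inr (.single (Or.inr ⟨_, _, rfl, rfl, h⟩)))))

theorem glue_S_minimal (s : P.carrier) (hs : s ∈ P.S) (b : GlueCarrier P Q) :
    ¬ gluePrec f b (glueLeft s) := by
  rintro (⟨x, y, rfl, h0, h⟩ | ⟨x, y, rfl, h0, h⟩ | ⟨x, y, rfl, h0, h1, h2⟩)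
  · rw [glueLeft_inj] at h0
    subst h0
    exact P.S_minimal _ hs _ h
  · obtain ⟨t, rfl, rfl⟩ := glueLeft_eq_glueRight.1 h0
    exact Q.S_minimal _ (f.toEquiv t).2 _ h
  · obtain ⟨t, rfl, rfl⟩ := glueLeft_eq_glueRight.1 h0
    exact h2 (f.toEquiv t).2

theorem glue_T_maximal (s : Q.carrier) (hs : s ∈ Q.T) (b : GlueCarrier P Q) :
    ¬ gluePrec f (glueRight f s) b := by
  rintro (⟨x, y, h0, rfl, h⟩ | ⟨x, y, h0, rfl, h⟩ | ⟨x, y, h0, rfl, h1, h2⟩)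
  · obtain ⟨t, rfl, rfl⟩ := glueLeft_eq_glueRight.1 h0.symm
    exact P.T_maximal _ t.2 _ h
  · rw [glueRight_inj] at h0
    subst h0
    exact Q.T_maximal _ hs _ h
  · obtain ⟨t, rfl, rfl⟩ := glueLeft_eq_glueRight.1 h0.symm
    exact h1 t.2

variable (P Q f)

/-- The gluing composition `P * Q` along an isomorphism `f : T_P ≅ S_Q` (which is unique if it
exists). -/
noncomputable def glue : IPoset Act where
  carrier := GlueCarrier P Q
  finite := by
    have := P.finite
    have := Q.finite
    infer_instance
  prec := gluePrec f
  evo := Relation.TransGen (glueEvoStep f)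
  S := glueLeft '' P.S
  T := glueRight f '' Q.T
  lab := Sum.elim P.lab (fun q => Q.lab q.1)
  prec_irrefl := gluePrec_irrefl
  prec_trans _ _ _ := gluePrec_trans
  evo_irrefl := glueEvo_irrefl
  evo_trans _ _ _ := Relation.TransGen.trans
  comparable := glue_comparable
  S_minimal := by
    rintro _ ⟨s, hs, rfl⟩ b
    exact glue_S_minimal s hs b
  T_maximal := by
    rintro _ ⟨s, hs, rfl⟩ b
    exact glue_T_maximal s hs b

end Glue

/-- The discrete iposet of a lo-set `U` with interfaces `S` and `T`. -/
def discrete (U : LoSet Act) (S T : Set (Fin U.n)) : IPoset Act where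
  carrier := Fin U.n
  finite := inferInstance
  prec _ _ := False
  evo i j := i < j
  S := S
  T := T
  lab := U.lab
  prec_irrefl _ h := h
  prec_trans _ _ _ h _ := h
  evo_irrefl := lt_irrefl
  evo_trans _ _ _ := lt_trans
  comparable x y := by
    rcases lt_trichotomy x y with h | h | h <;> tauto
  S_minimal _ _ _ h := h
  T_maximal _ _ _ h := h

end IPoset

/-- Ipomsets: isomorphism classes of labelled iposets. -/
def Ipomset (Act : Type u) := Quotient (IPoset.setoid Act)

namespace Ipomset

/-- The isomorphism class of a labelled iposet. -/
def mk (P : IPoset Act) : Ipomset Act := Quotient.mk _ P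

/-- The subsumption relation `P ⊑ Q` on ipomsets. -/
def Subsumed : Ipomset Act → Ipomset Act → Prop :=
  Quotient.lift₂ (fun P Q => Nonempty (IPoset.Subsumption P Q)) (by
    rintro P Q P' Q' ⟨f⟩ ⟨g⟩
    exact propext ⟨fun ⟨h⟩ => ⟨(f.symm.toSubsumption.trans h).trans g.toSubsumption⟩,
      fun ⟨h⟩ => ⟨(f.toSubsumption.trans h).trans g.symm.toSubsumption⟩⟩)

theorem Subsumed.trans {P Q R : Ipomset Act} (h : Subsumed P Q) (h' : Subsumed Q R) :
    Subsumed P R := by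
  induction P using Quotient.ind
  induction Q using Quotient.ind
  induction R using Quotient.ind
  obtain ⟨f⟩ := h
  obtain ⟨g⟩ := h'
  exact ⟨f.trans g⟩

theorem isInterval_of_iso {P Q : IPoset Act} (f : IPoset.Iso P Q) (h : P.IsInterval) :
    Q.IsInterval := by
  obtain ⟨b, e, hbe, h⟩ := h
  refine ⟨b ∘ f.toEquiv.symm, e ∘ f.toEquiv.symm, fun x => hbe _, fun x y => ?_⟩
  rw [Function.comp_apply, Function.comp_apply, ← h]
  exact ⟨fun h' => f.symm.map_prec _ _ h', fun h' => f.symm.reflect_prec _ _ h'⟩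

/-- Interval ipomsets. -/
def IsInterval : Ipomset Act → Prop :=
  Quotient.lift IPoset.IsInterval (by
    rintro P Q ⟨f⟩
    exact propext ⟨isInterval_of_iso f, isInterval_of_iso f.symm⟩)

theorem isSeparated_of_iso {P Q : IPoset Act} (f : IPoset.Iso P Q) (h : P.IsSeparated) :
    Q.IsSeparated := by
  obtain ⟨x, -, hx⟩ := h
  refine ⟨f.toEquiv x, trivial, ?_⟩
  rw [← f.map_S, ← f.map_T]
  simpa using hx

/-- Separated ipomsets. -/
def IsSeparated : Ipomset Act → Prop :=
  Quotient.lift IPoset.IsSeparated (by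
    rintro P Q ⟨f⟩
    exact propext ⟨isSeparated_of_iso f, isSeparated_of_iso f.symm⟩)

/-- The down-closure of a set of ipomsets, inside the set of interval ipomsets. -/
def downClosure (M : Set (Ipomset Act)) : Set (Ipomset Act) :=
  {P | P.IsInterval ∧ ∃ Q ∈ M, Subsumed P Q}

/-- The set of all `P * Q` with `P ∈ L`, `Q ∈ M` and `T_P ≅ S_Q`. -/
def glueSet (L M : Set (Ipomset Act)) : Set (Ipomset Act) :=
  {R | ∃ (P Q : IPoset Act) (f : IPoset.InterfaceIso P Q),
    mk P ∈ L ∧ mk Q ∈ M ∧ R = mk (IPoset.glue P Q f)}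

end Ipomset

/-! ### Languages -/

/-- An (interval ipomset) language: a set of interval ipomsets that is down-closed within the
interval ipomsets. -/
@[ext]
structure IpomsetLanguage (Act : Type u) where
  carrier : Set (Ipomset Act)
  interval : ∀ P ∈ carrier, P.IsInterval
  down_closed : ∀ P Q : Ipomset Act, P.IsInterval → P.Subsumed Q → Q ∈ carrier → P ∈ carrier

namespace IpomsetLanguage

/-- Gluing composition `L * M` of languages. -/
def glue (L M : IpomsetLanguage Act) : IpomsetLanguage Act where
  carrier := Ipomset.downClosure (Ipomset.glueSet L.carrier M.carrier)
  interval _ h := h.1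
  down_closed := by
    rintro P Q hP hPQ ⟨-, R, hR, hQR⟩
    exact ⟨hP, R, hR, hPQ.trans hQR⟩

/-- `L.powSucc n` is the power `L ^ (n + 1)`, where `L ^ 1 = L` and `L ^ (n + 1) = L * L ^ n`. -/
def powSucc (L : IpomsetLanguage Act) : ℕ → IpomsetLanguage Act
  | 0 => L
  | n + 1 => L.glue (L.powSucc n)

/-- The Kleene plus, the union of all powers `L ^ n` with `n ≥ 1`. -/
def kleenePlus (L : IpomsetLanguage Act) : IpomsetLanguage Act where
  carrier := ⋃ n : ℕ, (L.powSucc n).carrier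
  interval P h := by
    obtain ⟨n, hn⟩ := Set.mem_iUnion.1 h
    exact (L.powSucc n).interval P hn
  down_closed P Q hP hPQ h := by
    obtain ⟨n, hn⟩ := Set.mem_iUnion.1 h
    exact Set.mem_iUnion.2 ⟨n, (L.powSucc n).down_closed P Q hP hPQ hn⟩

/-- A language is separated if all its elements are. -/
def IsSeparated (L : IpomsetLanguage Act) : Prop :=
  ∀ P ∈ L.carrier, P.IsSeparated

end IpomsetLanguage

/-! ### Paths and their ipomsets -/

/-- A labelled iposet together with isomorphisms of its source interface with the lo-set `U` and of
its target interface with the lo-set `V`. -/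
structure IPosetArrow (U V : LoSet Act) where
  P : IPoset Act
  src : Fin U.n ≃ P.S
  src_evo : ∀ i j, i < j ↔ P.evo (src i) (src j)
  src_lab : ∀ i, P.lab (src i) = U.lab i
  tgt : Fin V.n ≃ P.T
  tgt_evo : ∀ i j, i < j ↔ P.evo (tgt i) (tgt j)
  tgt_lab : ∀ i, P.lab (tgt i) = V.lab i

namespace IPosetArrow

/-- The identity ipomset of `U`, with `S = U = T`. -/
def id (U : LoSet Act) : IPosetArrow U U where
  P := IPoset.discrete U Set.univ Set.univ
  src := (Equiv.Set.univ _).symm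
  src_evo _ _ := Iff.rfl
  src_lab _ := rfl
  tgt := (Equiv.Set.univ _).symm
  tgt_evo _ _ := Iff.rfl
  tgt_lab _ := rfl

/-- The ipomset of an up-step along `d : U → V` (which starts the events of `V \ U`): the carrier
is `V`, the source interface is `U` and the target interface is `V`. -/
noncomputable def starter {U V : LoSet Act} (d : Coface U V) : IPosetArrow U V where
  P := IPoset.discrete V (Set.range d.emb) Set.univ
  src := Equiv.ofInjective d.emb d.emb.injective
  src_evo _ _ := d.emb.lt_iff_lt.symm
  src_lab := d.lab
  tgt := (Equiv.Set.univ _).symm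
  tgt_evo _ _ := Iff.rfl
  tgt_lab _ := rfl

/-- The ipomset of a down-step along `d : V → U` (which terminates the events of `U \ V`): the
carrier is `U`, the source interface is `U` and the target interface is `V`. -/
noncomputable def terminator {U V : LoSet Act} (d : Coface V U) : IPosetArrow U V where
  P := IPoset.discrete U Set.univ (Set.range d.emb)
  src := (Equiv.Set.univ _).symm
  src_evo _ _ := Iff.rfl
  src_lab _ := rfl
  tgt := Equiv.ofInjective d.emb d.emb.injective
  tgt_evo _ _ := d.emb.lt_iff_lt.symm
  tgt_lab := d.lab

/-- The isomorphism along which two composable arrows are glued. -/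
def interfaceIso {U V W : LoSet Act} (p : IPosetArrow U V) (q : IPosetArrow V W) :
    IPoset.InterfaceIso p.P q.P where
  toEquiv := p.tgt.symm.trans q.src
  evo_iff x y := by
    obtain ⟨i, rfl⟩ := p.tgt.surjective x
    obtain ⟨j, rfl⟩ := p.tgt.surjective y
    simp only [Equiv.trans_apply, Equiv.symm_apply_apply]
    rw [← p.tgt_evo, ← q.src_evo]
  lab_eq x := by
    obtain ⟨i, rfl⟩ := p.tgt.surjective x
    simp only [Equiv.trans_apply, Equiv.symm_apply_apply]
    rw [q.src_lab, p.tgt_lab]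

/-- Gluing composition of composable arrows. -/
noncomputable def comp {U V W : LoSet Act} (p : IPosetArrow U V) (q : IPosetArrow V W) :
    IPosetArrow U W where
  P := IPoset.glue p.P q.P (p.interfaceIso q)
  src := p.src.trans (Equiv.Set.image _ p.P.S (fun _ _ h => IPoset.glueLeft_inj.1 h))
  src_evo i j := by
    rw [p.src_evo]
    constructor
    · intro h
      exact .single (Or.inl ⟨_, _, rfl, rfl, h⟩)
    · intro h
      by_contra h'
      rw [← p.src_evo, not_lt] at h'
      rcases h'.eq_or_lt with rfl | h'
      · exact IPoset.glueEvo_irrefl _ h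
      · rw [p.src_evo] at h'
        exact IPoset.glueEvo_irrefl _ (h.trans (.single (Or.inl ⟨_, _, rfl, rfl, h'⟩)))
  src_lab i := p.src_lab i
  tgt := q.tgt.trans (Equiv.Set.image _ q.P.T (fun _ _ h => IPoset.glueRight_inj.1 h))
  tgt_evo i j := by
    rw [q.tgt_evo]
    constructor
    · intro h
      exact .single (Or.inr ⟨_, _, rfl, rfl, h⟩)
    · intro h
      by_contra h'
      rw [← q.tgt_evo, not_lt] at h'
      rcases h'.eq_or_lt with rfl | h'
      · exact IPoset.glueEvo_irrefl _ h
      · rw [q.tgt_evo] at h'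
        exact IPoset.glueEvo_irrefl _ (h.trans (.single (Or.inr ⟨_, _, rfl, rfl, h'⟩)))
  tgt_lab i := by
    rw [← q.tgt_lab i]
    change Sum.elim p.P.lab (fun q' => q.P.lab q'.1)
      (IPoset.glueRight (p.interfaceIso q) (q.tgt i).1) = _
    unfold IPoset.glueRight
    split_ifs with h
    · have := (p.interfaceIso q).lab_eq ((p.interfaceIso q).toEquiv.symm ⟨_, h⟩)
      rw [Equiv.apply_symm_apply] at this
      exact this.symm
    · rfl

end IPosetArrow

/-- Paths in a presheaf `X` on a category `C` over the labelled precube category: `C` is the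
labelled precube category itself for precubical sets and the labelled precube category with
interfaces for ipc-sets. A path is a sequence of up-steps `δ⁰_A(y) → y` and down-steps
`x → δ¹_B(x)`. -/
inductive Path {C : Type v} [Category.{w} C] (F : C ⥤ LoSet Act) (X : Cᵒᵖ ⥤ Type w') :
    {U V : C} → X.obj (op U) → X.obj (op V) → Type (max u v w w') where
  | nil {U : C} (x : X.obj (op U)) : Path F X x x
  | up {U V W : C} {x : X.obj (op U)} {y : X.obj (op V)} {z : X.obj (op W)} (d : U ⟶ V)
      (hB : (F.map d : Coface (F.obj U) (F.obj V)).B = ∅) (hx : X.map d.op y = x)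
      (p : Path F X y z) : Path F X x z
  | down {U V W : C} {x : X.obj (op U)} {y : X.obj (op V)} {z : X.obj (op W)} (d : V ⟶ U)
      (hA : (F.map d : Coface (F.obj V) (F.obj U)).A = ∅) (hy : X.map d.op x = y)
      (p : Path F X y z) : Path F X x z

/-- The ipomset of a path: the gluing composition of the ipomsets of its steps. -/
noncomputable def Path.ev {C : Type v} [Category.{w} C] {F : C ⥤ LoSet Act}
    {X : Cᵒᵖ ⥤ Type w'} {U V : C} {x : X.obj (op U)} {y : X.obj (op V)} :
    Path F X x y → IPosetArrow (F.obj U) (F.obj V)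
  | .nil _ => IPosetArrow.id _
  | .up d _ _ p => (IPosetArrow.starter (F.map d)).comp p.ev
  | .down d _ _ p => (IPosetArrow.terminator (F.map d)).comp p.ev

/-! ### Higher-dimensional automata -/

/-- A higher-dimensional automaton: a finite precubical set with start and accept cells. -/
structure HDA (Act : Type u) where
  X : (LoSet Act)ᵒᵖ ⥤ Type u
  finite : Finite (Σ U : LoSet Act, X.obj (op U))
  start : ∀ U : LoSet Act, Set (X.obj (op U))
  accept : ∀ U : LoSet Act, Set (X.obj (op U))

/-- A higher-dimensional automaton with interfaces: a finite ipc-set with start and accept cells,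
such that all events of start cells are in the source interface and all events of accept cells are
in the target interface. -/
structure IHDA (Act : Type u) where
  X : (ILoSet Act)ᵒᵖ ⥤ Type u
  finite : Finite (Σ U : ILoSet Act, X.obj (op U))
  start : ∀ U : ILoSet Act, Set (X.obj (op U))
  accept : ∀ U : ILoSet Act, Set (X.obj (op U))
  start_interface : ∀ U, ∀ x ∈ start U, U.S = Set.univ
  accept_interface : ∀ U, ∀ x ∈ accept U, U.T = Set.univ

/-- The set of ipomsets of accepting paths of an HDA. -/
def HDA.lang (H : HDA Act) : Set (Ipomset Act) :=
  {P | ∃ (U V : LoSet Act) (x : H.X.obj (op U)) (y : H.X.obj (op V))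
    (p : Path (𝟭 (LoSet Act)) H.X x y),
    x ∈ H.start U ∧ y ∈ H.accept V ∧ P = Ipomset.mk p.ev.P}

/-- The set of ipomsets of accepting paths of an iHDA. -/
def IHDA.lang (H : IHDA Act) : Set (Ipomset Act) :=
  {P | ∃ (U V : ILoSet Act) (x : H.X.obj (op U)) (y : H.X.obj (op V))
    (p : Path (forgetInterfaces Act) H.X x y),
    x ∈ H.start U ∧ y ∈ H.accept V ∧ P = Ipomset.mk p.ev.P}

/-- The language is recognised by some HDA. -/
def IpomsetLanguage.RecognisedByHDA (L : IpomsetLanguage Act) : Prop :=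
  ∃ H : HDA Act, H.lang = L.carrier

/-- The language is recognised by some iHDA. -/
def IpomsetLanguage.RecognisedByIHDA (L : IpomsetLanguage Act) : Prop :=
  ∃ H : IHDA Act, H.lang = L.carrier

end HigherDim

namespace HigherDim

universe u v w w'

variable {Act : Type u}

/-! ### Presentations of gluing compositions -/

/-! Add to the given automaton silent jumps from accept cells to start cells with the same events.
Accepting runs then spell iterated gluings of ipomsets of `L`, so an ipomset lies in `L⁺` exactly
when it is interval and subsumed by the ipomset of an accepting run of this finite graph
(`mk_mem_kleenePlus_iff`). Instead of gluing cells, an HDA is built from this predicate in the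
manner of Myhill and Nerode.

Finiteness: suppose `p * q` is subsumed by the ipomset of a run. The events that end in `p` and
those that begin in `q` cut the run at some node `z` (`Run.exists_split`). The common interface of
`p` and `q` embeds into the events of `z`, and the other events of `z` are either not yet started by
`p` or already terminated by `p`: a coface map into the lo-set of `z` (`Gluing.exists_parts`).
Conversely, two halves with the same position can be recombined (`LowerPart.comp_subsumption`).
Hence the set of completions of a prefix `p` depends only on the set of positions it can reach
(`accepts_comp_iff`), a subset of a finite set.

The automaton: a cell over `U` is a family of sets of completions, one for each face of `U`. A
prefix `p` yields the cell of quotients by its faces, where a face deletes unstarted events and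
drops terminated ones from the target interface. Terminating events is a gluing, so it is tracked
exactly. Unstarting events and restarting them last produces a more ordered iposet, so only an
inclusion survives. The resulting conditions suffice for soundness (`quot_of_path`). For
completeness, an interval iposet is an identity, or ends with a start that follows all terminated
events, or ends with a termination (`exists_decomposition`); so every interval prefix with a
completion is reached by a path with exactly its ipomset (`exists_path_to_cell`). Completions are
words of starters and terminators rather than arbitrary iposets, which keeps the cells in `Type u`.

Finally, equipping the cells of an HDA with all possible interfaces gives an iHDA with the same
language (`lang_toIHDA`). -/

/-- A strictly monotone self-map of `Fin n` is the identity. -/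
theorem strictMono_fin_eq_self {n : ℕ} {g : Fin n → Fin n} (hg : StrictMono g) (i : Fin n) :
    g i = i := by
  have hs : Function.Surjective g := Finite.surjective_of_injective hg.injective
  exact congrFun ((hg.range_inj strictMono_id).1 (by simp [hs.range_eq])) i

namespace IPoset

theorem not_evo_of_evo (P : IPoset Act) {x y : P.carrier} (h : P.evo x y) : ¬ P.evo y x :=
  fun h' => P.evo_irrefl _ (P.evo_trans _ _ _ h h')

theorem not_prec_of_prec (P : IPoset Act) {x y : P.carrier} (h : P.prec x y) : ¬ P.prec y x :=
  fun h' => P.prec_irrefl _ (P.prec_trans _ _ _ h h')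

theorem subsumption_of_equiv {P Q : IPoset Act} (h : P ≈ Q) : Nonempty (Subsumption P Q) :=
  Nonempty.map Iso.toSubsumption h

end IPoset

namespace IPosetArrow

variable {U V W U' V' W' : LoSet Act}

theorem src_mem (p : IPosetArrow U V) (i : Fin U.n) : (p.src i).1 ∈ p.P.S := (p.src i).2

theorem tgt_mem (p : IPosetArrow U V) (i : Fin V.n) : (p.tgt i).1 ∈ p.P.T := (p.tgt i).2

theorem exists_src (p : IPosetArrow U V) {x : p.P.carrier} (hx : x ∈ p.P.S) :
    ∃ i, x = (p.src i).1 := ⟨p.src.symm ⟨x, hx⟩, by simp⟩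

theorem exists_tgt (p : IPosetArrow U V) {x : p.P.carrier} (hx : x ∈ p.P.T) :
    ∃ i, x = (p.tgt i).1 := ⟨p.tgt.symm ⟨x, hx⟩, by simp⟩

theorem src_inj (p : IPosetArrow U V) {i j : Fin U.n} (h : (p.src i).1 = (p.src j).1) : i = j :=
  p.src.injective (Subtype.ext h)

theorem tgt_inj (p : IPosetArrow U V) {i j : Fin V.n} (h : (p.tgt i).1 = (p.tgt j).1) : i = j :=
  p.tgt.injective (Subtype.ext h)

/-- Subsumptions respect the parametrisations of source interfaces. -/
theorem map_src {p : IPosetArrow U V} {q : IPosetArrow U W} (f : IPoset.Subsumption p.P q.P)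
    (i : Fin U.n) : f.toEquiv (p.src i) = q.src i := by
  have hS : ∀ i, f.toEquiv (p.src i) ∈ q.P.S := fun i => f.map_S ▸ ⟨_, p.src_mem i, rfl⟩
  -- Source events are `<`-minimal, hence pairwise incomparable, so the subsumption preserves their
  -- event order; a strictly monotone self-map of `Fin n` leaves no choice.
  have hg : StrictMono fun i => q.src.symm ⟨f.toEquiv (p.src i), hS i⟩ := by
    intro i j hij
    have := f.map_evo _ _ ((p.src_evo i j).1 hij) (p.P.S_minimal _ (p.src_mem j) _)
      (p.P.S_minimal _ (p.src_mem i) _)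
    rw [q.src_evo]
    simpa using this
  have := strictMono_fin_eq_self hg i
  rw [Equiv.symm_apply_eq] at this
  exact congrArg Subtype.val this

/-- Subsumptions respect the parametrisations of target interfaces. -/
theorem map_tgt {p : IPosetArrow U V} {q : IPosetArrow W V} (f : IPoset.Subsumption p.P q.P)
    (i : Fin V.n) : f.toEquiv (p.tgt i) = q.tgt i := by
  have hT : ∀ i, f.toEquiv (p.tgt i) ∈ q.P.T := fun i => f.map_T ▸ ⟨_, p.tgt_mem i, rfl⟩
  have hg : StrictMono fun i => q.tgt.symm ⟨f.toEquiv (p.tgt i), hT i⟩ := by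
    intro i j hij
    have := f.map_evo _ _ ((p.tgt_evo i j).1 hij) (p.P.T_maximal _ (p.tgt_mem i) _)
      (p.P.T_maximal _ (p.tgt_mem j) _)
    rw [q.tgt_evo]
    simpa using this
  have := strictMono_fin_eq_self hg i
  rw [Equiv.symm_apply_eq] at this
  exact congrArg Subtype.val this

/-- `Gluing p q r` presents `r` as the gluing composition of `p` and `q`. -/
structure Gluing (p : IPosetArrow U V) (q : IPosetArrow V W) (r : IPosetArrow U W) where
  inl : p.P.carrier → r.P.carrier
  inr : q.P.carrier → r.P.carrier
  inl_injective : Function.Injective inl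
  inr_injective : Function.Injective inr
  inl_tgt : ∀ i, inl (p.tgt i) = inr (q.src i)
  meet : ∀ x y, inl x = inr y → ∃ i, x = p.tgt i ∧ y = q.src i
  cover : ∀ z, (∃ x, inl x = z) ∨ ∃ y, inr y = z
  inl_src : ∀ i, inl (p.src i) = r.src i
  inr_tgt : ∀ i, inr (q.tgt i) = r.tgt i
  lab_inl : ∀ x, r.P.lab (inl x) = p.P.lab x
  lab_inr : ∀ y, r.P.lab (inr y) = q.P.lab y
  prec_inl : ∀ x y, r.P.prec (inl x) (inl y) ↔ p.P.prec x y
  prec_inr : ∀ x y, r.P.prec (inr x) (inr y) ↔ q.P.prec x y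
  prec_inl_inr : ∀ x y, x ∉ p.P.T → y ∉ q.P.S → r.P.prec (inl x) (inr y)
  -- Only `<`-incomparable pairs matter: elsewhere the event order is not invariant under
  -- isomorphism.
  evo_inl : ∀ x y, p.P.evo x y → ¬ p.P.prec x y → ¬ p.P.prec y x → r.P.evo (inl x) (inl y)
  evo_inr : ∀ x y, q.P.evo x y → ¬ q.P.prec x y → ¬ q.P.prec y x → r.P.evo (inr x) (inr y)

/-- The gluing composition is presented by the structural inclusions. -/
noncomputable def compGluing (p : IPosetArrow U V) (q : IPosetArrow V W) :
    Gluing p q (p.comp q) where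
  inl := IPoset.glueLeft
  inr := IPoset.glueRight (p.interfaceIso q)
  inl_injective _ _ h := IPoset.glueLeft_inj.1 h
  inr_injective _ _ h := IPoset.glueRight_inj.1 h
  inl_tgt i := IPoset.glueLeft_eq_glueRight.2 ⟨p.tgt i, rfl, by simp [interfaceIso]⟩
  meet x y h := by
    obtain ⟨t, rfl, rfl⟩ := IPoset.glueLeft_eq_glueRight.1 h
    exact ⟨p.tgt.symm t, by simp, by simp [interfaceIso]⟩
  cover z := by
    rcases IPoset.exists_glueLeft_or_glueRight (f := p.interfaceIso q) z with ⟨x, rfl⟩ | ⟨y, -, rfl⟩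
    · exact Or.inl ⟨x, rfl⟩
    · exact Or.inr ⟨y, rfl⟩
  inl_src _ := rfl
  inr_tgt _ := rfl
  lab_inl _ := rfl
  lab_inr y := by
    change Sum.elim p.P.lab (fun q' => q.P.lab q'.1) (IPoset.glueRight (p.interfaceIso q) y) = _
    unfold IPoset.glueRight
    split_ifs with h
    · have := (p.interfaceIso q).lab_eq ((p.interfaceIso q).toEquiv.symm ⟨_, h⟩)
      rw [Equiv.apply_symm_apply] at this
      exact this.symm
    · rfl
  prec_inl x y := by
    refine ⟨?_, fun h => Or.inl ⟨x, y, rfl, rfl, h⟩⟩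
    rintro (⟨a, b, ha, hb, h⟩ | ⟨a, b, ha, hb, h⟩ | ⟨a, b, ha, hb, h1, h2⟩)
    · rw [IPoset.glueLeft_inj] at ha hb
      rwa [ha, hb]
    · obtain ⟨t, rfl, rfl⟩ := IPoset.glueLeft_eq_glueRight.1 hb
      exact absurd h (q.P.S_minimal _ (Subtype.mem _) _)
    · obtain ⟨t, rfl, rfl⟩ := IPoset.glueLeft_eq_glueRight.1 hb
      exact absurd (Subtype.mem _) h2
  prec_inr x y := by
    refine ⟨?_, fun h => Or.inr (Or.inl ⟨x, y, rfl, rfl, h⟩)⟩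
    rintro (⟨a, b, ha, hb, h⟩ | ⟨a, b, ha, hb, h⟩ | ⟨a, b, ha, hb, h1, h2⟩)
    · obtain ⟨t, rfl, rfl⟩ := IPoset.glueLeft_eq_glueRight.1 ha.symm
      exact absurd h (p.P.T_maximal _ (Subtype.mem _) _)
    · rw [IPoset.glueRight_inj] at ha hb
      rwa [ha, hb]
    · obtain ⟨t, rfl, rfl⟩ := IPoset.glueLeft_eq_glueRight.1 ha.symm
      exact absurd (Subtype.mem _) h1
  prec_inl_inr x y hx hy := Or.inr (Or.inr ⟨x, y, rfl, rfl, hx, hy⟩)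
  evo_inl x y h _ _ := .single (Or.inl ⟨x, y, rfl, rfl, h⟩)
  evo_inr x y h _ _ := .single (Or.inr ⟨x, y, rfl, rfl, h⟩)

namespace Gluing

variable {p : IPosetArrow U V} {q : IPosetArrow V W} {r : IPosetArrow U W}

/-- Case distinction for an element of a gluing composition. -/
theorem cases_right (g : Gluing p q r) (z : r.P.carrier) :
    (∃ x, z = g.inl x) ∨ ∃ y, y ∉ q.P.S ∧ z = g.inr y := by
  rcases g.cover z with ⟨x, rfl⟩ | ⟨y, rfl⟩
  · exact Or.inl ⟨x, rfl⟩
  · by_cases hy : y ∈ q.P.S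
    · obtain ⟨i, rfl⟩ := q.exists_src hy
      exact Or.inl ⟨_, (g.inl_tgt i).symm⟩
    · exact Or.inr ⟨y, hy, rfl⟩

/-- Case distinction for a pair of elements of a gluing composition. -/
theorem pair_cases (g : Gluing p q r) {C : r.P.carrier → r.P.carrier → Prop}
    (hl : ∀ x y, C (g.inl x) (g.inl y)) (hr : ∀ x y, C (g.inr x) (g.inr y))
    (hlr : ∀ x y, x ∉ p.P.T → y ∉ q.P.S → C (g.inl x) (g.inr y))
    (hrl : ∀ x y, x ∉ p.P.T → y ∉ q.P.S → C (g.inr y) (g.inl x)) (a b : r.P.carrier) : C a b := by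
  rcases g.cases_right a with ⟨x, rfl⟩ | ⟨x, hx, rfl⟩ <;>
    rcases g.cases_right b with ⟨y, rfl⟩ | ⟨y, hy, rfl⟩
  · exact hl x y
  · by_cases h : x ∈ p.P.T
    · obtain ⟨i, rfl⟩ := p.exists_tgt h
      rw [g.inl_tgt]
      exact hr _ _
    · exact hlr x y h hy
  · by_cases h : y ∈ p.P.T
    · obtain ⟨i, rfl⟩ := p.exists_tgt h
      rw [g.inl_tgt]
      exact hr _ _
    · exact hrl y x h hx
  · exact hr x y

theorem not_prec_inr_inl (g : Gluing p q r) {x : p.P.carrier} {y : q.P.carrier} (hx : x ∉ p.P.T)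
    (hy : y ∉ q.P.S) : ¬ r.P.prec (g.inr y) (g.inl x) :=
  r.P.not_prec_of_prec (g.prec_inl_inr x y hx hy)

theorem inl_mem_S (g : Gluing p q r) {x : p.P.carrier} : g.inl x ∈ r.P.S ↔ x ∈ p.P.S := by
  constructor
  · intro h
    obtain ⟨i, hi⟩ := r.exists_src h
    rw [← g.inl_src] at hi
    rw [g.inl_injective hi]
    exact p.src_mem i
  · intro h
    obtain ⟨i, rfl⟩ := p.exists_src h
    rw [g.inl_src]
    exact r.src_mem i

theorem inr_mem_T (g : Gluing p q r) {x : q.P.carrier} : g.inr x ∈ r.P.T ↔ x ∈ q.P.T := by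
  constructor
  · intro h
    obtain ⟨i, hi⟩ := r.exists_tgt h
    rw [← g.inr_tgt] at hi
    rw [g.inr_injective hi]
    exact q.tgt_mem i
  · intro h
    obtain ⟨i, rfl⟩ := q.exists_tgt h
    rw [g.inr_tgt]
    exact r.tgt_mem i

/-- By comparability in `p`, the only alternative is the opposite event order, which `inl` would
carry to a contradiction with asymmetry in `r`. -/
theorem evo_inl_of_evo (g : Gluing p q r) {x y : p.P.carrier} (h : r.P.evo (g.inl x) (g.inl y))
    (h1 : ¬ p.P.prec x y) (h2 : ¬ p.P.prec y x) : p.P.evo x y := by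
  rcases p.P.comparable x y with rfl | h' | h' | h' | h'
  · exact absurd h (r.P.evo_irrefl _)
  · exact absurd h' h1
  · exact absurd h' h2
  · exact h'
  · exact absurd h (r.P.not_evo_of_evo (g.evo_inl _ _ h' h2 h1))

theorem evo_inr_of_evo (g : Gluing p q r) {x y : q.P.carrier} (h : r.P.evo (g.inr x) (g.inr y))
    (h1 : ¬ q.P.prec x y) (h2 : ¬ q.P.prec y x) : q.P.evo x y := by
  rcases q.P.comparable x y with rfl | h' | h' | h' | h'
  · exact absurd h (r.P.evo_irrefl _)
  · exact absurd h' h1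
  · exact absurd h' h2
  · exact h'
  · exact absurd h (r.P.not_evo_of_evo (g.evo_inr _ _ h' h2 h1))

/-- Maps out of a gluing composition. -/
theorem exists_desc (g : Gluing p q r) {Z : Type*} (h₁ : p.P.carrier → Z) (h₂ : q.P.carrier → Z)
    (h : ∀ i, h₁ (p.tgt i) = h₂ (q.src i)) :
    ∃ f : r.P.carrier → Z, (∀ x, f (g.inl x) = h₁ x) ∧ ∀ y, f (g.inr y) = h₂ y := by
  have key : ∀ z, ∃ v, (∀ x, g.inl x = z → v = h₁ x) ∧ ∀ y, g.inr y = z → v = h₂ y := by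
    intro z
    rcases g.cover z with ⟨x, rfl⟩ | ⟨y, rfl⟩
    · refine ⟨h₁ x, fun x' hx => by rw [g.inl_injective hx], fun y hy => ?_⟩
      obtain ⟨i, rfl, rfl⟩ := g.meet _ _ hy.symm
      exact h i
    · refine ⟨h₂ y, fun x hx => ?_, fun y' hy => by rw [g.inr_injective hy]⟩
      obtain ⟨i, rfl, rfl⟩ := g.meet _ _ hx
      exact (h i).symm
  choose f hf using key
  exact ⟨f, fun x => (hf _).1 _ rfl, fun y => (hf _).2 _ rfl⟩

/-- Subsumptions out of a gluing composition. -/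
theorem exists_subsumption (g : Gluing p q r) {Z : IPoset Act}
    (h₁ : p.P.carrier → Z.carrier) (h₂ : q.P.carrier → Z.carrier)
    (inj₁ : Function.Injective h₁) (inj₂ : Function.Injective h₂)
    (htgt : ∀ i, h₁ (p.tgt i) = h₂ (q.src i))
    (meet : ∀ x y, h₁ x = h₂ y → ∃ i, x = p.tgt i ∧ y = q.src i)
    (cover : ∀ a, (∃ x, h₁ x = a) ∨ ∃ y, h₂ y = a)
    (hS : h₁ '' p.P.S = Z.S) (hT : h₂ '' q.P.T = Z.T)
    (lab₁ : ∀ x, Z.lab (h₁ x) = p.P.lab x) (lab₂ : ∀ x, Z.lab (h₂ x) = q.P.lab x)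
    (prec₁ : ∀ x y, Z.prec (h₁ x) (h₁ y) → p.P.prec x y)
    (prec₂ : ∀ x y, Z.prec (h₂ x) (h₂ y) → q.P.prec x y)
    (prec₂₁ : ∀ x y, x ∉ p.P.T → y ∉ q.P.S → ¬ Z.prec (h₂ y) (h₁ x))
    (evo₁ : ∀ x y, p.P.evo x y → ¬ p.P.prec x y → ¬ p.P.prec y x → Z.evo (h₁ x) (h₁ y))
    (evo₂ : ∀ x y, q.P.evo x y → ¬ q.P.prec x y → ¬ q.P.prec y x → Z.evo (h₂ x) (h₂ y)) :
    ∃ f : IPoset.Subsumption r.P Z, (∀ x, f.toEquiv (g.inl x) = h₁ x) ∧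
      ∀ y, f.toEquiv (g.inr y) = h₂ y := by
  obtain ⟨f, fl, fr⟩ := g.exists_desc h₁ h₂ htgt
  have bij : Function.Bijective f := by
    constructor
    · intro a b
      refine g.pair_cases (C := fun a b => f a = f b → a = b) ?_ ?_ ?_ ?_ a b
      · intro x y h
        rw [fl, fl] at h
        rw [inj₁ h]
      · intro x y h
        rw [fr, fr] at h
        rw [inj₂ h]
      · intro x y hx hy h
        rw [fl, fr] at h
        obtain ⟨i, rfl, rfl⟩ := meet _ _ h
        exact g.inl_tgt i
      · intro x y hx hy h
        rw [fl, fr] at h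
        obtain ⟨i, rfl, rfl⟩ := meet _ _ h.symm
        exact (g.inl_tgt i).symm
    · intro a
      rcases cover a with ⟨x, rfl⟩ | ⟨y, rfl⟩
      · exact ⟨_, fl x⟩
      · exact ⟨_, fr y⟩
  refine ⟨⟨Equiv.ofBijective f bij, ?_, ?_, ?_, ?_, ?_⟩, fl, fr⟩
  · rw [← hS]
    ext a
    constructor
    · rintro ⟨b, hb, rfl⟩
      obtain ⟨i, rfl⟩ := r.exists_src hb
      refine ⟨p.src i, p.src_mem i, ?_⟩
      rw [← g.inl_src]
      exact (fl _).symm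
    · rintro ⟨b, hb, rfl⟩
      exact ⟨g.inl b, g.inl_mem_S.2 hb, fl b⟩
  · rw [← hT]
    ext a
    constructor
    · rintro ⟨b, hb, rfl⟩
      obtain ⟨i, rfl⟩ := r.exists_tgt hb
      refine ⟨q.tgt i, q.tgt_mem i, ?_⟩
      rw [← g.inr_tgt]
      exact (fr _).symm
    · rintro ⟨b, hb, rfl⟩
      exact ⟨g.inr b, g.inr_mem_T.2 hb, fr b⟩
  · intro a
    rcases g.cover a with ⟨x, rfl⟩ | ⟨y, rfl⟩
    · rw [Equiv.ofBijective_apply, fl, lab₁, g.lab_inl]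
    · rw [Equiv.ofBijective_apply, fr, lab₂, g.lab_inr]
  · intro a b
    rw [Equiv.ofBijective_apply, Equiv.ofBijective_apply]
    refine g.pair_cases (C := fun a b => Z.prec (f a) (f b) → r.P.prec a b) ?_ ?_ ?_ ?_ a b
    · intro x y
      rw [fl, fl, g.prec_inl]
      exact prec₁ x y
    · intro x y
      rw [fr, fr, g.prec_inr]
      exact prec₂ x y
    · intro x y hx hy _
      exact g.prec_inl_inr x y hx hy
    · intro x y hx hy h
      rw [fl, fr] at h
      exact absurd h (prec₂₁ x y hx hy)
  · intro a b
    rw [Equiv.ofBijective_apply, Equiv.ofBijective_apply]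
    refine g.pair_cases (C := fun a b => r.P.evo a b → ¬ r.P.prec a b → ¬ r.P.prec b a →
      Z.evo (f a) (f b)) ?_ ?_ ?_ ?_ a b
    · intro x y h h1 h2
      rw [g.prec_inl] at h1 h2
      rw [fl, fl]
      exact evo₁ _ _ (g.evo_inl_of_evo h h1 h2) h1 h2
    · intro x y h h1 h2
      rw [g.prec_inr] at h1 h2
      rw [fr, fr]
      exact evo₂ _ _ (g.evo_inr_of_evo h h1 h2) h1 h2
    -- Mixed pairs are already ordered by `<` in `r`, so the event order imposes nothing on them.
    · intro x y hx hy _ h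
      exact absurd (g.prec_inl_inr x y hx hy) h
    · intro x y hx hy _ _ h
      exact absurd (g.prec_inl_inr x y hx hy) h

/-- Gluing composition is monotone with respect to subsumption. -/
theorem mono {p' : IPosetArrow U' V} {q' : IPosetArrow V W'} {r' : IPosetArrow U' W'}
    (g : Gluing p q r) (g' : Gluing p' q' r') (a : IPoset.Subsumption p.P p'.P)
    (b : IPoset.Subsumption q.P q'.P) :
    ∃ f : IPoset.Subsumption r.P r'.P, (∀ x, f.toEquiv (g.inl x) = g'.inl (a.toEquiv x)) ∧
      ∀ y, f.toEquiv (g.inr y) = g'.inr (b.toEquiv y) := by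
  refine g.exists_subsumption (fun x => g'.inl (a.toEquiv x))
    (fun y => g'.inr (b.toEquiv y))
    (g'.inl_injective.comp a.toEquiv.injective) (g'.inr_injective.comp b.toEquiv.injective)
    ?_ ?_ ?_ ?_ ?_ ?_ ?_ ?_ ?_ ?_ ?_ ?_
  · intro i
    rw [map_tgt (q := p'), map_src (q := q'), g'.inl_tgt]
  · intro x y h
    obtain ⟨i, hx, hy⟩ := g'.meet _ _ h
    rw [← map_tgt a] at hx
    rw [← map_src b] at hy
    exact ⟨i, a.toEquiv.injective hx, b.toEquiv.injective hy⟩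
  · intro z
    rcases g'.cover z with ⟨x, rfl⟩ | ⟨y, rfl⟩
    · exact Or.inl ⟨a.toEquiv.symm x, by simp⟩
    · exact Or.inr ⟨b.toEquiv.symm y, by simp⟩
  · rw [← Set.image_image, a.map_S]
    ext z
    constructor
    · rintro ⟨x, hx, rfl⟩
      exact g'.inl_mem_S.2 hx
    · intro hz
      obtain ⟨i, rfl⟩ := r'.exists_src hz
      exact ⟨_, p'.src_mem i, g'.inl_src i⟩
  · rw [← Set.image_image, b.map_T]
    ext z
    constructor
    · rintro ⟨x, hx, rfl⟩
      exact g'.inr_mem_T.2 hx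
    · intro hz
      obtain ⟨i, rfl⟩ := r'.exists_tgt hz
      exact ⟨_, q'.tgt_mem i, g'.inr_tgt i⟩
  · intro x
    rw [g'.lab_inl, a.map_lab]
  · intro x
    rw [g'.lab_inr, b.map_lab]
  · intro x y h
    rw [g'.prec_inl] at h
    exact a.reflect_prec _ _ h
  · intro x y h
    rw [g'.prec_inr] at h
    exact b.reflect_prec _ _ h
  · intro x y hx hy
    refine g'.not_prec_inr_inl ?_ ?_
    · rw [← a.map_T]
      simpa using hx
    · rw [← b.map_S]
      simpa using hy
  · intro x y h h1 h2
    exact g'.evo_inl _ _ (a.map_evo _ _ h h1 h2) (fun h' => h1 (a.reflect_prec _ _ h'))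
      (fun h' => h2 (a.reflect_prec _ _ h'))
  · intro x y h h1 h2
    exact g'.evo_inr _ _ (b.map_evo _ _ h h1 h2) (fun h' => h1 (b.reflect_prec _ _ h'))
      (fun h' => h2 (b.reflect_prec _ _ h'))

/-- Gluing composition respects isomorphism. -/
theorem congr {p' : IPosetArrow U' V} {q' : IPosetArrow V W'} {r' : IPosetArrow U' W'}
    (g : Gluing p q r) (g' : Gluing p' q' r') (a : p.P ≈ p'.P) (b : q.P ≈ q'.P) :
    r.P ≈ r'.P := by
  obtain ⟨a⟩ := a
  obtain ⟨b⟩ := b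
  obtain ⟨f, fl, fr⟩ := g.mono g' a.toSubsumption b.toSubsumption
  refine ⟨{ f with map_prec := ?_ }⟩
  refine g.pair_cases ?_ ?_ ?_ ?_
  · intro x y h
    rw [fl, fl, g'.prec_inl]
    exact a.map_prec _ _ ((g.prec_inl _ _).1 h)
  · intro x y h
    rw [fr, fr, g'.prec_inr]
    exact b.map_prec _ _ ((g.prec_inr _ _).1 h)
  · intro x y hx hy _
    rw [fl, fr]
    refine g'.prec_inl_inr _ _ ?_ ?_
    · rw [← a.map_T]
      simpa using hx
    · rw [← b.map_S]
      simpa using hy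
  · intro x y hx hy h
    exact absurd h (g.not_prec_inr_inl hx hy)

/-- A presented gluing composition is isomorphic to the gluing composition. -/
theorem equiv_comp (g : Gluing p q r) : r.P ≈ (p.comp q).P :=
  g.congr (compGluing p q) (Setoid.refl _) (Setoid.refl _)

/-- Reassociation: `t = e * (p * q)` is presented as `(e * p) * q`. -/
theorem exists_assoc {Z : LoSet Act} {e : IPosetArrow Z U} {t : IPosetArrow Z W}
    {ea : IPosetArrow Z V} (g : Gluing p q r) (ge : Gluing e r t) (ga : Gluing e p ea) :
    ∃ h : Gluing ea q t, (∀ x, h.inl (ga.inl x) = ge.inl x) ∧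
      (∀ x, h.inl (ga.inr x) = ge.inr (g.inl x)) ∧ ∀ y, h.inr y = ge.inr (g.inr y) := by
  -- The left inclusion of the new presentation is assembled from the inclusions of `e` and of `p`
  -- into `t`.
  obtain ⟨f, fl, fr⟩ := ga.exists_desc ge.inl (fun x => ge.inr (g.inl x)) (fun i => by
    rw [ge.inl_tgt, g.inl_src])
  have hS : ∀ {x}, g.inl x ∉ r.P.S ↔ x ∉ p.P.S := not_congr g.inl_mem_S
  refine ⟨⟨f, fun y => ge.inr (g.inr y), ?_, ge.inr_injective.comp g.inr_injective, ?_, ?_, ?_, ?_,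
    ?_, ?_, ?_, ?_, ?_, ?_, ?_, ?_⟩, fl, fr, fun _ => rfl⟩
  · intro a b
    refine ga.pair_cases (C := fun a b => f a = f b → a = b) ?_ ?_ ?_ ?_ a b
    · intro x y h
      rw [fl, fl] at h
      rw [ge.inl_injective h]
    · intro x y h
      rw [fr, fr] at h
      rw [g.inl_injective (ge.inr_injective h)]
    · intro x y hx hy h
      rw [fl, fr] at h
      obtain ⟨i, rfl, -⟩ := ge.meet _ _ h
      exact absurd (e.tgt_mem i) hx
    · intro x y hx hy h
      rw [fl, fr] at h
      obtain ⟨i, rfl, -⟩ := ge.meet _ _ h.symm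
      exact absurd (e.tgt_mem i) hx
  · intro i
    rw [← ga.inr_tgt, fr, g.inl_tgt]
  · intro x y h
    rcases ga.cover x with ⟨x, rfl⟩ | ⟨x, rfl⟩
    · rw [fl] at h
      obtain ⟨i, rfl, hi⟩ := ge.meet _ _ h
      rw [← g.inl_src] at hi
      obtain ⟨j, hj, rfl⟩ := g.meet _ _ hi.symm
      refine ⟨j, ?_, rfl⟩
      rw [ga.inl_tgt, hj, ga.inr_tgt]
    · rw [fr] at h
      obtain ⟨j, rfl, rfl⟩ := g.meet _ _ (ge.inr_injective h)
      exact ⟨j, ga.inr_tgt j, rfl⟩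
  · intro z
    rcases ge.cover z with ⟨x, rfl⟩ | ⟨y, rfl⟩
    · exact Or.inl ⟨_, fl x⟩
    · rcases g.cover y with ⟨x, rfl⟩ | ⟨y, rfl⟩
      · exact Or.inl ⟨_, fr x⟩
      · exact Or.inr ⟨y, rfl⟩
  · intro i
    rw [← ga.inl_src, fl, ge.inl_src]
  · intro i
    rw [g.inr_tgt, ge.inr_tgt]
  · intro x
    rcases ga.cover x with ⟨x, rfl⟩ | ⟨x, rfl⟩
    · rw [fl, ge.lab_inl, ga.lab_inl]
    · rw [fr, ge.lab_inr, g.lab_inl, ga.lab_inr]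
  · intro x
    rw [ge.lab_inr, g.lab_inr]
  · refine ga.pair_cases ?_ ?_ ?_ ?_
    · intro x y
      rw [fl, fl, ge.prec_inl, ga.prec_inl]
    · intro x y
      rw [fr, fr, ge.prec_inr, g.prec_inl, ga.prec_inr]
    · intro x y hx hy
      rw [fl, fr]
      exact iff_of_true (ge.prec_inl_inr _ _ hx (hS.2 hy)) (ga.prec_inl_inr _ _ hx hy)
    · intro x y hx hy
      rw [fl, fr]
      exact iff_of_false (ge.not_prec_inr_inl hx (hS.2 hy)) (ga.not_prec_inr_inl hx hy)
  · intro x y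
    rw [ge.prec_inr, g.prec_inr]
  · intro x y hx hy
    have hy' : g.inr y ∉ r.P.S := by
      intro h
      obtain ⟨i, hi⟩ := r.exists_src h
      rw [← g.inl_src] at hi
      obtain ⟨j, -, rfl⟩ := g.meet _ _ hi.symm
      exact hy (q.src_mem j)
    rcases ga.cover x with ⟨x, rfl⟩ | ⟨x, rfl⟩
    · rw [fl]
      -- A target event of `e` is also a source event of `p`. Not being a target event of `e * p`,
      -- it is terminated within `p` and so precedes the later events already inside `p * q`.
      by_cases h : x ∈ e.P.T
      · obtain ⟨i, rfl⟩ := e.exists_tgt h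
        rw [ge.inl_tgt, ge.prec_inr, ← g.inl_src]
        refine g.prec_inl_inr _ _ (fun h' => hx ?_) hy
        rw [ga.inl_tgt]
        exact ga.inr_mem_T.2 h'
      · exact ge.prec_inl_inr _ _ h hy'
    · rw [fr, ge.prec_inr]
      exact g.prec_inl_inr _ _ (fun h' => hx (ga.inr_mem_T.2 h')) hy
  · intro a b
    refine ga.pair_cases (C := fun a b => ea.P.evo a b → ¬ ea.P.prec a b → ¬ ea.P.prec b a →
      t.P.evo (f a) (f b)) ?_ ?_ ?_ ?_ a b
    · intro x y h h1 h2
      rw [ga.prec_inl] at h1 h2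
      rw [fl, fl]
      exact ge.evo_inl _ _ (ga.evo_inl_of_evo h h1 h2) h1 h2
    · intro x y h h1 h2
      rw [ga.prec_inr] at h1 h2
      rw [fr, fr]
      refine ge.evo_inr _ _ (g.evo_inl _ _ (ga.evo_inr_of_evo h h1 h2) h1 h2) ?_ ?_
      · rwa [g.prec_inl]
      · rwa [g.prec_inl]
    · intro x y hx hy _ h
      exact absurd (ga.prec_inl_inr x y hx hy) h
    · intro x y hx hy _ _ h
      exact absurd (ga.prec_inl_inr x y hx hy) h
  · intro x y h h1 h2
    refine ge.evo_inr _ _ (g.evo_inr _ _ h h1 h2) ?_ ?_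
    · rwa [g.prec_inr]
    · rwa [g.prec_inr]

/-- Left unit. -/
def idLeft (q : IPosetArrow U V) : Gluing (IPosetArrow.id U) q q where
  inl i := q.src i
  inr := _root_.id
  inl_injective _ _ h := q.src_inj h
  inr_injective := Function.injective_id
  inl_tgt _ := rfl
  meet i _ h := ⟨i, rfl, h.symm⟩
  cover z := Or.inr ⟨z, rfl⟩
  inl_src _ := rfl
  inr_tgt _ := rfl
  lab_inl := q.src_lab
  lab_inr _ := rfl
  prec_inl _ j := iff_of_false (q.P.S_minimal _ (q.src_mem j) _) (fun h => h)
  prec_inr _ _ := Iff.rfl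
  prec_inl_inr _ _ h := absurd trivial h
  evo_inl i j h _ _ := (q.src_evo i j).1 h
  evo_inr _ _ h _ _ := h

/-- Right unit. -/
def idRight (p : IPosetArrow U V) : Gluing p (IPosetArrow.id V) p where
  inl := _root_.id
  inr i := p.tgt i
  inl_injective := Function.injective_id
  inr_injective _ _ h := p.tgt_inj h
  inl_tgt _ := rfl
  meet _ i h := ⟨i, h, rfl⟩
  cover z := Or.inl ⟨z, rfl⟩
  inl_src _ := rfl
  inr_tgt _ := rfl
  lab_inl _ := rfl
  lab_inr := p.tgt_lab
  prec_inl _ _ := Iff.rfl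
  prec_inr i _ := iff_of_false (p.P.T_maximal _ (p.tgt_mem i) _) (fun h => h)
  prec_inl_inr _ _ _ h := absurd trivial h
  evo_inl _ _ h _ _ := h
  evo_inr i j h _ _ := (p.tgt_evo i j).1 h

end Gluing

theorem comp_assoc {Z : LoSet Act} (p : IPosetArrow U V) (q : IPosetArrow V W)
    (r : IPosetArrow W Z) : ((p.comp q).comp r).P ≈ (p.comp (q.comp r)).P := by
  obtain ⟨h, -⟩ := (compGluing q r).exists_assoc (compGluing p (q.comp r)) (compGluing p q)
  exact Setoid.symm h.equiv_comp

theorem id_comp (q : IPosetArrow U V) : ((IPosetArrow.id U).comp q).P ≈ q.P :=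
  Setoid.symm (Gluing.idLeft q).equiv_comp

theorem comp_id (q : IPosetArrow U V) : (q.comp (IPosetArrow.id V)).P ≈ q.P :=
  Setoid.symm (Gluing.idRight q).equiv_comp

theorem comp_congr {p : IPosetArrow U V} {q : IPosetArrow V W} {p' : IPosetArrow U' V}
    {q' : IPosetArrow V W'} (hp : p.P ≈ p'.P) (hq : q.P ≈ q'.P) : (p.comp q).P ≈ (p'.comp q').P :=
  (compGluing p q).congr (compGluing p' q') hp hq

theorem comp_mono {p : IPosetArrow U V} {q : IPosetArrow V W} {p' : IPosetArrow U' V}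
    {q' : IPosetArrow V W'} (hp : Nonempty (IPoset.Subsumption p.P p'.P))
    (hq : Nonempty (IPoset.Subsumption q.P q'.P)) :
    Nonempty (IPoset.Subsumption (p.comp q).P (p'.comp q').P) := by
  obtain ⟨a⟩ := hp
  obtain ⟨b⟩ := hq
  exact ⟨((compGluing p q).mono (compGluing p' q') a b).choose⟩

end IPosetArrow

/-! ### Interval representations of gluing compositions -/

namespace IPosetArrow

variable {U V W U' V' W' : LoSet Act}

namespace Gluing

variable {p : IPosetArrow U V} {q : IPosetArrow V W} {r : IPosetArrow U W}

/-- Interface events make no exception: if `x` is in `T_P` it is a source event of `q`, minimal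
there; if `y` is in `S_Q` it is a target event of `p`, maximal there. -/
theorem not_prec_inr_inl' (g : Gluing p q r) (x : p.P.carrier) (y : q.P.carrier) :
    ¬ r.P.prec (g.inr y) (g.inl x) := by
  by_cases hx : x ∈ p.P.T
  · obtain ⟨i, rfl⟩ := p.exists_tgt hx
    rw [g.inl_tgt, g.prec_inr]
    exact q.P.S_minimal _ (q.src_mem i) _
  · by_cases hy : y ∈ q.P.S
    · obtain ⟨i, rfl⟩ := q.exists_src hy
      rw [← g.inl_tgt, g.prec_inl]
      exact p.P.T_maximal _ (p.tgt_mem i) _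
    · exact g.not_prec_inr_inl hx hy

theorem cases_left (g : Gluing p q r) (z : r.P.carrier) :
    (∃ y, z = g.inr y) ∨ ∃ x, x ∉ p.P.T ∧ z = g.inl x := by
  rcases g.cover z with ⟨x, rfl⟩ | ⟨y, rfl⟩
  · by_cases hx : x ∈ p.P.T
    · obtain ⟨i, rfl⟩ := p.exists_tgt hx
      exact Or.inl ⟨_, g.inl_tgt i⟩
    · exact Or.inr ⟨x, hx, rfl⟩
  · exact Or.inl ⟨y, rfl⟩

/-- Gluing compositions of interval iposets are interval. -/
theorem isInterval (g : Gluing p q r) (hp : p.P.IsInterval) (hq : q.P.IsInterval) :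
    r.P.IsInterval := by
  obtain ⟨b₁, e₁, hbe₁, h₁⟩ := hp
  obtain ⟨b₂, e₂, hbe₂, h₂⟩ := hq
  have := p.P.finite
  have := q.P.finite
  obtain ⟨M₁, hM₁⟩ := (Set.finite_range b₁).bddAbove
  obtain ⟨M₂, hM₂⟩ := (Set.finite_range e₁).bddAbove
  obtain ⟨m₁, hm₁⟩ := (Set.finite_range b₂).bddBelow
  have hb₁ : ∀ x, b₁ x ≤ M₁ := fun x => hM₁ ⟨x, rfl⟩
  have he₁ : ∀ x, e₁ x ≤ M₂ := fun x => hM₂ ⟨x, rfl⟩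
  have hb₂ : ∀ x, m₁ ≤ b₂ x := fun x => hm₁ ⟨x, rfl⟩
  -- The representation of `q` is shifted by `c`, beyond all begin and end points of `p`.
  obtain ⟨c, hc₁, hc₂⟩ : ∃ c, M₁ < m₁ + c ∧ M₂ < m₁ + c :=
    ⟨max M₁ M₂ - m₁ + 1, by linarith [le_max_left M₁ M₂], by linarith [le_max_right M₁ M₂]⟩
  -- An event of the common interface begins at its time in `p` and ends at its shifted time in `q`;
  -- all others keep both endpoints of their own factor.
  have key : ∀ z, ∃ b e : ℝ, ((∀ x, g.inl x = z → b = b₁ x) ∧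
      ∀ y, y ∉ q.P.S → g.inr y = z → b = b₂ y + c) ∧
      (∀ x, x ∉ p.P.T → g.inl x = z → e = e₁ x) ∧ ∀ y, g.inr y = z → e = e₂ y + c := by
    intro z
    have hb : ∃ b : ℝ, (∀ x, g.inl x = z → b = b₁ x) ∧
        ∀ y, y ∉ q.P.S → g.inr y = z → b = b₂ y + c := by
      rcases g.cases_right z with ⟨x, rfl⟩ | ⟨y, hy, rfl⟩
      · refine ⟨b₁ x, fun x' hx => by rw [g.inl_injective hx], fun y hy h => ?_⟩
        obtain ⟨i, -, rfl⟩ := g.meet _ _ h.symm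
        exact absurd (q.src_mem i) hy
      · refine ⟨b₂ y + c, fun x hx => ?_, fun y' _ hx => by rw [g.inr_injective hx]⟩
        obtain ⟨i, -, rfl⟩ := g.meet _ _ hx
        exact absurd (q.src_mem i) hy
    have he : ∃ e : ℝ, (∀ x, x ∉ p.P.T → g.inl x = z → e = e₁ x) ∧
        ∀ y, g.inr y = z → e = e₂ y + c := by
      rcases g.cases_left z with ⟨y, rfl⟩ | ⟨x, hx, rfl⟩
      · refine ⟨e₂ y + c, fun x hx h => ?_, fun y' hx => by rw [g.inr_injective hx]⟩
        obtain ⟨i, rfl, -⟩ := g.meet _ _ h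
        exact absurd (p.tgt_mem i) hx
      · refine ⟨e₁ x, fun x' _ hx => by rw [g.inl_injective hx], fun y h => ?_⟩
        obtain ⟨i, rfl, -⟩ := g.meet _ _ h.symm
        exact absurd (p.tgt_mem i) hx
    obtain ⟨b, hb⟩ := hb
    obtain ⟨e, he⟩ := he
    exact ⟨b, e, hb, he⟩
  choose b e hb he using key
  have hbl : ∀ x, b (g.inl x) = b₁ x := fun x => (hb _).1 _ rfl
  have hbr : ∀ y, y ∉ q.P.S → b (g.inr y) = b₂ y + c := fun y hy => (hb _).2 _ hy rfl
  have hel : ∀ x, x ∉ p.P.T → e (g.inl x) = e₁ x := fun x hx => (he _).1 _ hx rfl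
  have her : ∀ y, e (g.inr y) = e₂ y + c := fun y => (he _).2 _ rfl
  refine ⟨b, e, fun z => ?_, ?_⟩
  · rcases g.cases_right z with ⟨x, rfl⟩ | ⟨y, hy, rfl⟩
    · by_cases hx : x ∈ p.P.T
      · obtain ⟨i, rfl⟩ := p.exists_tgt hx
        rw [hbl, g.inl_tgt, her]
        linarith [hb₁ (p.tgt i), hb₂ (q.src i), hbe₂ (q.src i)]
      · rw [hbl, hel x hx]
        exact hbe₁ x
    · rw [hbr y hy, her]
      linarith [hbe₂ y]
  · refine g.pair_cases ?_ ?_ ?_ ?_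
    · intro x y
      rw [g.prec_inl, hbl]
      by_cases hx : x ∈ p.P.T
      · obtain ⟨i, rfl⟩ := p.exists_tgt hx
        refine iff_of_false (p.P.T_maximal _ hx _) ?_
        rw [g.inl_tgt, her]
        linarith [hb₁ y, hb₂ (q.src i), hbe₂ (q.src i)]
      · rw [hel x hx, h₁]
    · intro x y
      rw [g.prec_inr, her]
      by_cases hy : y ∈ q.P.S
      · obtain ⟨i, rfl⟩ := q.exists_src hy
        refine iff_of_false (q.P.S_minimal _ hy _) ?_
        rw [← g.inl_tgt, hbl]
        linarith [hb₁ (p.tgt i), hb₂ x, hbe₂ x]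
      · rw [hbr y hy, h₂]
        exact ⟨fun h => by linarith, fun h => by linarith⟩
    · intro x y hx hy
      refine iff_of_true (g.prec_inl_inr x y hx hy) ?_
      rw [hel x hx, hbr y hy]
      linarith [he₁ x, hb₂ y]
    · intro x y _ _
      refine iff_of_false (g.not_prec_inr_inl' x y) ?_
      rw [her, hbl]
      linarith [hb₁ x, hb₂ y, hbe₂ y]

end Gluing

/-! ### Cutting and recombining subsumptions -/

/-- The events of `w` outside the target events unstarted by `d`: a presentation of `p` as a
subsumption of the corresponding face of `w`. -/
structure LowerPart (p : IPosetArrow U V) (d : Coface V V') (w : IPosetArrow U' V') where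
  e : p.P.carrier → w.P.carrier
  injective : Function.Injective e
  cover : ∀ z, (∃ x, e x = z) ∨ ∃ i ∈ d.A, z = w.tgt i
  avoid : ∀ x, ∀ i ∈ d.A, e x ≠ w.tgt i
  tgt : ∀ i, e (p.tgt i) = w.tgt (d.emb i)
  image_S : e '' p.P.S = w.P.S
  lab : ∀ x, w.P.lab (e x) = p.P.lab x
  prec : ∀ x y, w.P.prec (e x) (e y) → p.P.prec x y
  evo : ∀ x y, p.P.evo x y → ¬ p.P.prec x y → ¬ p.P.prec y x → w.P.evo (e x) (e y)

/-- The events of `w` outside the source events terminated by `d`: a presentation of `q` as a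
subsumption of the corresponding coface of `w`. -/
structure UpperPart (q : IPosetArrow V W) (d : Coface V V') (w : IPosetArrow V' W') where
  e : q.P.carrier → w.P.carrier
  injective : Function.Injective e
  cover : ∀ z, (∃ x, e x = z) ∨ ∃ i ∈ d.B, z = w.src i
  avoid : ∀ x, ∀ i ∈ d.B, e x ≠ w.src i
  src : ∀ i, e (q.src i) = w.src (d.emb i)
  image_T : e '' q.P.T = w.P.T
  lab : ∀ x, w.P.lab (e x) = q.P.lab x
  prec : ∀ x y, w.P.prec (e x) (e y) → q.P.prec x y
  evo : ∀ x y, q.P.evo x y → ¬ q.P.prec x y → ¬ q.P.prec y x → w.P.evo (e x) (e y)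

/-- The boundary events missing from `p` form `A`, those missing from `q` form `B`. As these are
disjoint, each is supplied by the other factor; those lying in both are exactly the events of `V`.
So the two parts jointly cover `a * b` and meet only in the interface. -/
theorem LowerPart.comp_subsumption {p : IPosetArrow U V} {q : IPosetArrow V W} {d : Coface V V'}
    {a : IPosetArrow U' V'} {b : IPosetArrow V' W'} (hp : LowerPart p d a) (hq : UpperPart q d b) :
    Nonempty (IPoset.Subsumption (p.comp q).P (a.comp b).P) := by
  let g := compGluing a b
  have hd : ∀ x, (x ∈ d.A ∨ x ∈ d.B) ↔ ¬ ∃ y, d.emb y = x := fun x => by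
    simpa using Set.ext_iff.1 d.union x
  have hAB : ∀ {i}, i ∈ d.A → i ∉ d.B := fun h h' => Set.disjoint_left.1 d.disj h h'
  refine ⟨((compGluing p q).exists_subsumption (Z := (a.comp b).P) (fun x => g.inl (hp.e x))
    (fun y => g.inr (hq.e y)) (g.inl_injective.comp hp.injective)
    (g.inr_injective.comp hq.injective) ?_ ?_ ?_ ?_ ?_ ?_ ?_ ?_ ?_ ?_ ?_ ?_).choose⟩
  · intro i
    rw [hp.tgt, hq.src, g.inl_tgt]
  · intro x y h
    obtain ⟨j, hx, hy⟩ := g.meet _ _ h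
    have : ∃ i, d.emb i = j := by
      by_contra hj
      rcases (hd j).2 hj with h | h
      · exact hp.avoid x j h hx
      · exact hq.avoid y j h hy
    obtain ⟨i, rfl⟩ := this
    rw [← hp.tgt] at hx
    rw [← hq.src] at hy
    exact ⟨i, hp.injective hx, hq.injective hy⟩
  · intro z
    rcases g.cover z with ⟨z, rfl⟩ | ⟨z, rfl⟩
    · rcases hp.cover z with ⟨x, rfl⟩ | ⟨i, hi, rfl⟩
      · exact Or.inl ⟨x, rfl⟩
      · rcases hq.cover (b.src i) with ⟨y, hy⟩ | ⟨j, hj, hij⟩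
        · exact Or.inr ⟨y, by rw [hy, g.inl_tgt]⟩
        · rw [b.src_inj hij] at hi
          exact absurd hj (hAB hi)
    · rcases hq.cover z with ⟨x, rfl⟩ | ⟨i, hi, rfl⟩
      · exact Or.inr ⟨x, rfl⟩
      · rcases hp.cover (a.tgt i) with ⟨y, hy⟩ | ⟨j, hj, hij⟩
        · exact Or.inl ⟨y, by rw [hy, g.inl_tgt]⟩
        · rw [a.tgt_inj hij] at hi
          exact absurd hi (hAB hj)
  · rw [← Set.image_image g.inl, hp.image_S]
    rfl
  · rw [← Set.image_image g.inr, hq.image_T]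
    rfl
  · intro x
    rw [g.lab_inl, hp.lab]
  · intro x
    rw [g.lab_inr, hq.lab]
  · intro x y h
    exact hp.prec _ _ ((g.prec_inl _ _).1 h)
  · intro x y h
    exact hq.prec _ _ ((g.prec_inr _ _).1 h)
  · intro x y _ _
    exact g.not_prec_inr_inl' _ _
  · intro x y h h1 h2
    exact g.evo_inl _ _ (hp.evo _ _ h h1 h2) (fun h' => h1 (hp.prec _ _ h'))
      (fun h' => h2 (hp.prec _ _ h'))
  · intro x y h h1 h2
    exact g.evo_inr _ _ (hq.evo _ _ h h1 h2) (fun h' => h1 (hq.prec _ _ h'))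
      (fun h' => h2 (hq.prec _ _ h'))

/-- A subsumption between gluing compositions that maps the boundary of the factors of the domain
to a cut compatible with the factors of the codomain is induced by a coface map. -/
theorem Gluing.exists_parts {U₁ W₁ : LoSet Act} {p : IPosetArrow U V} {q : IPosetArrow V W}
    {s : IPosetArrow U W} {a : IPosetArrow U₁ V'} {b : IPosetArrow V' W₁} {r : IPosetArrow U₁ W₁}
    (k : Gluing p q s) (g : Gluing a b r) (f : IPoset.Subsumption s.P r.P)
    (hD : ∀ z, z ∉ a.P.T → ∃ x, x ∉ p.P.T ∧ f.toEquiv (k.inl x) = g.inl z)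
    (hZ : ∀ z, z ∉ b.P.S → ∃ y, y ∉ q.P.S ∧ f.toEquiv (k.inr y) = g.inr z) :
    ∃ d : Coface V V', Nonempty (LowerPart p d a) ∧ Nonempty (UpperPart q d b) := by
  -- An event of `p` landing beyond `a` would, by `hZ`, also be the image of an event of `q` outside
  -- its source interface, contradicting injectivity.
  have h₁ : ∀ x, ∃ z, g.inl z = f.toEquiv (k.inl x) := by
    intro x
    rcases g.cases_right (f.toEquiv (k.inl x)) with ⟨z, hz⟩ | ⟨z, hz, hxz⟩
    · exact ⟨z, hz.symm⟩
    · obtain ⟨y, hy, hyz⟩ := hZ z hz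
      rw [← hyz] at hxz
      obtain ⟨i, -, rfl⟩ := k.meet _ _ (f.toEquiv.injective hxz)
      exact absurd (q.src_mem i) hy
  have h₂ : ∀ y, ∃ z, g.inr z = f.toEquiv (k.inr y) := by
    intro y
    rcases g.cases_left (f.toEquiv (k.inr y)) with ⟨z, hz⟩ | ⟨z, hz, hxz⟩
    · exact ⟨z, hz.symm⟩
    · obtain ⟨x, hx, hyz⟩ := hD z hz
      rw [← hyz] at hxz
      obtain ⟨i, rfl, -⟩ := k.meet _ _ (f.toEquiv.injective hxz).symm
      exact absurd (p.tgt_mem i) hx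
  choose e₁ he₁ using h₁
  choose e₂ he₂ using h₂
  have inj₁ : Function.Injective e₁ := fun x y h =>
    k.inl_injective (f.toEquiv.injective (by rw [← he₁, ← he₁, h]))
  have inj₂ : Function.Injective e₂ := fun x y h =>
    k.inr_injective (f.toEquiv.injective (by rw [← he₂, ← he₂, h]))
  have lab₁ : ∀ x, a.P.lab (e₁ x) = p.P.lab x := fun x => by
    rw [← g.lab_inl, he₁, f.map_lab, k.lab_inl]
  have lab₂ : ∀ x, b.P.lab (e₂ x) = q.P.lab x := fun x => by
    rw [← g.lab_inr, he₂, f.map_lab, k.lab_inr]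
  have prec₁ : ∀ x y, a.P.prec (e₁ x) (e₁ y) → p.P.prec x y := fun x y h => by
    rw [← g.prec_inl, he₁, he₁] at h
    exact (k.prec_inl _ _).1 (f.reflect_prec _ _ h)
  have prec₂ : ∀ x y, b.P.prec (e₂ x) (e₂ y) → q.P.prec x y := fun x y h => by
    rw [← g.prec_inr, he₂, he₂] at h
    exact (k.prec_inr _ _).1 (f.reflect_prec _ _ h)
  have evo₁ : ∀ x y, p.P.evo x y → ¬ p.P.prec x y → ¬ p.P.prec y x → a.P.evo (e₁ x) (e₁ y) := by
    intro x y h h1 h2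
    refine g.evo_inl_of_evo ?_ (fun h' => h1 (prec₁ _ _ h')) (fun h' => h2 (prec₁ _ _ h'))
    rw [he₁, he₁]
    exact f.map_evo _ _ (k.evo_inl _ _ h h1 h2) (by rwa [k.prec_inl]) (by rwa [k.prec_inl])
  have evo₂ : ∀ x y, q.P.evo x y → ¬ q.P.prec x y → ¬ q.P.prec y x → b.P.evo (e₂ x) (e₂ y) := by
    intro x y h h1 h2
    refine g.evo_inr_of_evo ?_ (fun h' => h1 (prec₂ _ _ h')) (fun h' => h2 (prec₂ _ _ h'))
    rw [he₂, he₂]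
    exact f.map_evo _ _ (k.evo_inr _ _ h h1 h2) (by rwa [k.prec_inr]) (by rwa [k.prec_inr])
  -- An event terminated in `a` comes, by `hD`, from an event terminated in `p`, so target events of
  -- `p` stay target events.
  have hT : ∀ i, ∃ j, e₁ (p.tgt i) = a.tgt j := by
    intro i
    refine a.exists_tgt ?_
    by_contra h
    obtain ⟨x, hx, h'⟩ := hD _ h
    rw [he₁] at h'
    rw [k.inl_injective (f.toEquiv.injective h')] at hx
    exact hx (p.tgt_mem i)
  choose m hm using hT
  have hm' : ∀ i, e₂ (q.src i) = b.src (m i) := fun i => g.inr_injective (by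
    rw [he₂, ← k.inl_tgt, ← he₁, hm, g.inl_tgt])
  have mono : StrictMono m := by
    intro i j hij
    rw [a.tgt_evo, ← hm, ← hm]
    exact evo₁ _ _ ((p.tgt_evo i j).1 hij) (p.P.T_maximal _ (p.tgt_mem i) _)
      (p.P.T_maximal _ (p.tgt_mem j) _)
  -- The events of the cut `V'` that do not come from `p` are unstarted there, those that do not
  -- come from `q` are already terminated. Disjointness of the two sets is surjectivity of `f`, and
  -- events from both factors come from `V`.
  let d : Coface V V' :=
    { emb := OrderEmbedding.ofStrictMono m mono
      A := {j | ∀ x, e₁ x ≠ a.tgt j}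
      B := {j | ∀ y, e₂ y ≠ b.src j}
      lab := fun i => by
        rw [← p.tgt_lab, ← lab₁, hm, a.tgt_lab]
        rfl
      disj := by
        rw [Set.disjoint_left]
        intro j hA hB
        obtain ⟨z, hz⟩ := f.toEquiv.surjective (g.inl (a.tgt j))
        rcases k.cover z with ⟨x, rfl⟩ | ⟨y, rfl⟩
        · rw [← he₁] at hz
          exact hA x (g.inl_injective hz)
        · rw [← he₂, g.inl_tgt] at hz
          exact hB y (g.inr_injective hz)
      union := by
        ext j
        simp only [Set.mem_union, Set.mem_ofPred_eq, Set.mem_compl_iff, Set.mem_range,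
          OrderEmbedding.coe_ofStrictMono]
        constructor
        · rintro (h | h) ⟨i, rfl⟩
          · exact h _ (hm i)
          · exact h _ (hm' i)
        · intro h
          by_contra! h'
          obtain ⟨⟨x, hx⟩, y, hy⟩ := h'
          have : k.inl x = k.inr y := f.toEquiv.injective (by
            rw [← he₁, ← he₂, hx, hy, g.inl_tgt])
          obtain ⟨i, rfl, -⟩ := k.meet _ _ this
          rw [hm] at hx
          exact h ⟨i, a.tgt_inj hx⟩ }
  refine ⟨d, ⟨⟨e₁, inj₁, ?_, fun x i hi => hi x, hm, ?_, lab₁, prec₁, evo₁⟩⟩,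
    ⟨⟨e₂, inj₂, ?_, fun x i hi => hi x, hm', ?_, lab₂, prec₂, evo₂⟩⟩⟩
  · intro z
    by_cases hz : z ∈ a.P.T
    · obtain ⟨j, rfl⟩ := a.exists_tgt hz
      by_cases h : ∃ x, e₁ x = a.tgt j
      · exact Or.inl h
      · exact Or.inr ⟨j, fun x hx => h ⟨x, hx⟩, rfl⟩
    · obtain ⟨x, -, hx⟩ := hD z hz
      exact Or.inl ⟨x, g.inl_injective (by rw [he₁, hx])⟩
  · ext z
    constructor
    · rintro ⟨x, hx, rfl⟩
      rw [← g.inl_mem_S, he₁, ← f.map_S]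
      exact ⟨_, k.inl_mem_S.2 hx, rfl⟩
    · intro hz
      rw [← g.inl_mem_S, ← f.map_S] at hz
      obtain ⟨z', hz', hzz⟩ := hz
      obtain ⟨i, rfl⟩ := s.exists_src hz'
      refine ⟨p.src i, p.src_mem i, g.inl_injective ?_⟩
      rw [he₁, k.inl_src, hzz]
  · intro z
    by_cases hz : z ∈ b.P.S
    · obtain ⟨j, rfl⟩ := b.exists_src hz
      by_cases h : ∃ x, e₂ x = b.src j
      · exact Or.inl h
      · exact Or.inr ⟨j, fun x hx => h ⟨x, hx⟩, rfl⟩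
    · obtain ⟨x, -, hx⟩ := hZ z hz
      exact Or.inl ⟨x, g.inr_injective (by rw [he₂, hx])⟩
  · ext z
    constructor
    · rintro ⟨x, hx, rfl⟩
      rw [← g.inr_mem_T, he₂, ← f.map_T]
      exact ⟨_, k.inr_mem_T.2 hx, rfl⟩
    · intro hz
      rw [← g.inr_mem_T, ← f.map_T] at hz
      obtain ⟨z', hz', hzz⟩ := hz
      obtain ⟨i, rfl⟩ := s.exists_tgt hz'
      refine ⟨q.tgt i, q.tgt_mem i, g.inr_injective ?_⟩
      rw [he₂, k.inr_tgt, hzz]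

end IPosetArrow

/-! ### Runs -/

/-- A transition graph whose nodes carry lo-sets; its edges start events, terminate events, or are
silent. -/
structure StepGraph (Act : Type u) where
  N : Type v
  ob : N → LoSet Act
  up : ∀ x y, Coface (ob x) (ob y) → Prop
  down : ∀ x y, Coface (ob y) (ob x) → Prop
  silent : N → N → Prop

namespace StepGraph

variable (G : StepGraph.{u, v} Act)

/-- `G.Run x y q`: there is a run from `x` to `y` with ipomset `q`. -/
inductive Run : G.N → G.N → ∀ {U V : LoSet Act}, IPosetArrow U V → Prop
  | nil (x : G.N) : Run x x (IPosetArrow.id (G.ob x))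
  | up {x y z : G.N} {V : LoSet Act} {q : IPosetArrow (G.ob y) V} {d : Coface (G.ob x) (G.ob y)} :
      G.up x y d → Run y z q → Run x z ((IPosetArrow.starter d).comp q)
  | down {x y z : G.N} {V : LoSet Act} {q : IPosetArrow (G.ob y) V}
      {d : Coface (G.ob y) (G.ob x)} :
      G.down x y d → Run y z q → Run x z ((IPosetArrow.terminator d).comp q)
  | silent {x y z : G.N} {U V : LoSet Act} {q : IPosetArrow U V} :
      G.silent x y → Run y z q → Run x z q

variable {G}

/-- Every cut of the ipomset of a run passes through a node of the run. -/
theorem Run.exists_split {x y : G.N} {U V : LoSet Act} {r : IPosetArrow U V} (h : G.Run x y r)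
    (D Z : Set r.P.carrier) (hDZ : ∀ a b, r.P.prec a b → b ∉ Z → a ∈ D) :
    ∃ (z : G.N) (a : IPosetArrow U (G.ob z)) (b : IPosetArrow (G.ob z) V)
      (g : IPosetArrow.Gluing a b r), G.Run x z a ∧ G.Run z y b ∧
      (∀ u, u ∉ a.P.T → g.inl u ∈ D) ∧ ∀ u, u ∉ b.P.S → g.inr u ∈ Z := by
  induction h with
  | nil x =>
    exact ⟨x, _, _, IPosetArrow.Gluing.idLeft _, .nil x, .nil x, fun u h => absurd trivial h,
      fun u h => absurd trivial h⟩
  | @up x y z V q d hd hr ih =>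
    let k := IPosetArrow.compGluing (IPosetArrow.starter d) q
    obtain ⟨w, a, b, g, ha, hb, hD, hZ⟩ := ih {u | k.inr u ∈ D} {u | k.inr u ∈ Z}
      (fun u v huv hv => hDZ _ _ ((k.prec_inr _ _).2 huv) hv)
    obtain ⟨g', hl, hlr, hr'⟩ := g.exists_assoc k (IPosetArrow.compGluing _ _)
    refine ⟨w, _, b, g', .up hd ha, hb, fun u hu => ?_, fun u hu => ?_⟩
    · rcases (IPosetArrow.compGluing (IPosetArrow.starter d) a).cases_left u with
        ⟨u, rfl⟩ | ⟨u, hu', -⟩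
      · rw [hlr]
        exact hD u (fun h => hu (IPosetArrow.Gluing.inr_mem_T _ |>.2 h))
      · exact absurd trivial hu'
    · rw [hr']
      exact hZ u hu
  | @down x y z V q d hd hr ih =>
    let k := IPosetArrow.compGluing (IPosetArrow.terminator d) q
    -- The cut is placed just before the first down-step that terminates an event outside `D`.
    -- Up-steps terminate nothing and can always be passed.
    by_cases hbD : ∀ u, u ∉ (IPosetArrow.terminator d).P.T → k.inl u ∈ D
    · obtain ⟨w, a, b, g, ha, hb, hD, hZ⟩ := ih {u | k.inr u ∈ D} {u | k.inr u ∈ Z}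
        (fun u v huv hv => hDZ _ _ ((k.prec_inr _ _).2 huv) hv)
      obtain ⟨g', hl, hlr, hr'⟩ := g.exists_assoc k (IPosetArrow.compGluing _ _)
      refine ⟨w, _, b, g', .down hd ha, hb, fun u hu => ?_, fun u hu => ?_⟩
      · rcases (IPosetArrow.compGluing (IPosetArrow.terminator d) a).cases_left u with
          ⟨u, rfl⟩ | ⟨u, hu', rfl⟩
        · rw [hlr]
          exact hD u (fun h => hu (IPosetArrow.Gluing.inr_mem_T _ |>.2 h))
        · rw [hl]
          exact hbD u hu'
      · rw [hr']
        exact hZ u hu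
    · push Not at hbD
      obtain ⟨e, he, heD⟩ := hbD
      refine ⟨x, _, _, IPosetArrow.Gluing.idLeft _, .nil x, .down hd hr,
        fun u h => absurd trivial h, fun u hu => ?_⟩
      rcases k.cases_right u with ⟨u, rfl⟩ | ⟨u, hu', rfl⟩
      · exact absurd (k.inl_mem_S.2 trivial) hu
      -- An event started later is preceded by `e`; were it outside `Z`, the hypothesis on `D` and
      -- `Z` would force `e ∈ D`.
      · by_contra h
        exact heD (hDZ _ _ (k.prec_inl_inr _ _ he hu') h)
  | silent hs _ ih =>
    obtain ⟨w, a, b, g, ha, hb, h⟩ := ih D Z hDZ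
    exact ⟨w, a, b, g, .silent hs ha, hb, h⟩

theorem Run.exists_append {x y z : G.N} {U V W : LoSet Act} {p : IPosetArrow U V}
    {q : IPosetArrow V W} (h : G.Run x y p) (h' : G.Run y z q) :
    ∃ r : IPosetArrow U W, G.Run x z r ∧ r.P ≈ (p.comp q).P := by
  induction h with
  | nil x => exact ⟨q, h', Setoid.symm (IPosetArrow.id_comp q)⟩
  | up hd _ ih =>
    obtain ⟨r, hr, e⟩ := ih h'
    exact ⟨_, .up hd hr, Setoid.trans (IPosetArrow.comp_congr (Setoid.refl _) e)
      (Setoid.symm (IPosetArrow.comp_assoc _ _ _))⟩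
  | down hd _ ih =>
    obtain ⟨r, hr, e⟩ := ih h'
    exact ⟨_, .down hd hr, Setoid.trans (IPosetArrow.comp_congr (Setoid.refl _) e)
      (Setoid.symm (IPosetArrow.comp_assoc _ _ _))⟩
  | silent hs _ ih =>
    obtain ⟨r, hr, e⟩ := ih h'
    exact ⟨_, .silent hs hr, e⟩

/-- `Run` keeps the ends of its arrow as free indices, so that a silent edge between nodes whose
lo-sets are merely propositionally equal leaves the arrow untouched. This recovers the ends. -/
theorem Run.ob_eq {x y : G.N} {U V : LoSet Act} {r : IPosetArrow U V}
    (hs : ∀ x y, G.silent x y → G.ob x = G.ob y) (h : G.Run x y r) :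
    U = G.ob x ∧ V = G.ob y := by
  induction h with
  | nil => exact ⟨rfl, rfl⟩
  | up _ _ ih => exact ⟨rfl, ih.2⟩
  | down _ _ ih => exact ⟨rfl, ih.2⟩
  | silent h _ ih => exact ⟨ih.1.trans (hs _ _ h).symm, ih.2⟩

/-! ### Acceptance and reachable positions -/

variable (G)
variable (start accept : Set G.N)

/-- `P` is subsumed by the ipomset of an accepting run. -/
def Accepts (P : IPoset Act) : Prop :=
  ∃ x ∈ start, ∃ y ∈ accept, ∃ (U V : LoSet Act) (r : IPosetArrow U V), G.Run x y r ∧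
    Nonempty (IPoset.Subsumption P r.P)

theorem Accepts.of_subsumption {G : StepGraph.{u, v} Act} {start accept : Set G.N}
    {P Q : IPoset Act} (h : G.Accepts start accept Q) (f : Nonempty (IPoset.Subsumption P Q)) :
    G.Accepts start accept P := by
  obtain ⟨x, hx, y, hy, U, V, r, hr, ⟨g⟩⟩ := h
  exact ⟨x, hx, y, hy, U, V, r, hr, ⟨f.some.trans g⟩⟩

/-- The positions in the cells of `G` that can be reached with ipomset `p`. -/
def reach {U V : LoSet Act} (p : IPosetArrow U V) : Set (Σ z : G.N, Coface V (G.ob z)) :=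
  {c | ∃ x ∈ start, ∃ (U' : LoSet Act) (a : IPosetArrow U' (G.ob c.1)), G.Run x c.1 a ∧
    Nonempty (IPosetArrow.LowerPart p c.2 a)}

/-- Acceptance of `p * q` depends on `p` only through the reachable positions. -/
theorem accepts_comp_iff {U V W : LoSet Act} (p : IPosetArrow U V) (q : IPosetArrow V W) :
    G.Accepts start accept (p.comp q).P ↔ ∃ c ∈ G.reach start p, ∃ y ∈ accept,
      ∃ (W' : LoSet Act) (b : IPosetArrow (G.ob c.1) W'), G.Run c.1 y b ∧
        Nonempty (IPosetArrow.UpperPart q c.2 b) := by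
  constructor
  · rintro ⟨x, hx, y, hy, U', W', r, hr, ⟨f⟩⟩
    let k := IPosetArrow.compGluing p q
    -- `D` consists of the events ended within `p`, `Z` of those begun within `q`. If `u < v` with
    -- `v` outside `Z`, then `v` belongs to `p`, so `u` cannot come from `q` and is ended within
    -- `p`.
    obtain ⟨z, a, b, g, ha, hb, hD, hZ⟩ := hr.exists_split
      {c | ∃ x, x ∉ p.P.T ∧ f.toEquiv (k.inl x) = c} {c | ∃ y, y ∉ q.P.S ∧ f.toEquiv (k.inr y) = c}
      (by
        intro u v huv hv
        obtain ⟨u, rfl⟩ := f.toEquiv.surjective u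
        obtain ⟨v, rfl⟩ := f.toEquiv.surjective v
        replace huv := f.reflect_prec _ _ huv
        rcases k.cases_right v with ⟨v, rfl⟩ | ⟨v, hv', rfl⟩
        · rcases k.cases_left u with ⟨u, rfl⟩ | ⟨u, hu, rfl⟩
          · exact absurd huv (k.not_prec_inr_inl' _ _)
          · exact ⟨u, hu, rfl⟩
        · exact absurd ⟨v, hv', rfl⟩ hv)
    obtain ⟨d, hp, hq⟩ := k.exists_parts g f hD hZ
    exact ⟨⟨z, d⟩, ⟨x, hx, U', a, ha, hp⟩, y, hy, W', b, hb, hq⟩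
  · rintro ⟨⟨z, d⟩, ⟨x, hx, U', a, ha, ⟨hp⟩⟩, y, hy, W', b, hb, ⟨hq⟩⟩
    obtain ⟨r, hr, e⟩ := ha.exists_append hb
    obtain ⟨f⟩ := hp.comp_subsumption hq
    obtain ⟨f'⟩ := IPoset.subsumption_of_equiv (Setoid.symm e)
    exact ⟨x, hx, y, hy, U', W', r, hr, ⟨f.trans f'⟩⟩

end StepGraph

/-! ### Lo-sets and interfaces -/

/-- The objects are skeletal: once the lengths agree, a monotone bijection is the identity, so the
labellings agree too. -/
theorem LoSet.eq_of_equiv {U V : LoSet Act} (e : Fin U.n ≃ Fin V.n) (he : StrictMono e)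
    (hlab : ∀ i, V.lab (e i) = U.lab i) : U = V := by
  obtain ⟨n, lab⟩ := U
  obtain ⟨m, lab'⟩ := V
  obtain rfl : n = m := by simpa using Fintype.card_congr e
  congr
  ext i
  have h := strictMono_fin_eq_self he i
  have := hlab i
  rw [h] at this
  exact this.symm

/-- There are finitely many coface maps into a lo-set. -/
theorem finite_coface (U : LoSet Act) : Finite (Σ V : LoSet Act, Coface V U) := by
  -- `A` and `B` determine everything: the image is their complement, an order embedding is
  -- determined by its image, and length and labels of the domain are read off from it.
  refine Finite.of_injective (β := Set (Fin U.n) × Set (Fin U.n)) (fun d => (d.2.A, d.2.B)) ?_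
  rintro ⟨⟨n, lab⟩, d⟩ ⟨⟨m, lab'⟩, d'⟩ h
  obtain ⟨hA, hB⟩ : d.A = d'.A ∧ d.B = d'.B := Prod.ext_iff.1 h
  have hr : Set.range d.emb = Set.range d'.emb := by
    rw [← compl_inj_iff, ← d.union, ← d'.union, hA, hB]
  obtain rfl : n = m := by
    have h1 := Nat.card_congr (Equiv.ofInjective d.emb d.emb.injective)
    have h2 := Nat.card_congr (Equiv.ofInjective d'.emb d'.emb.injective)
    rw [hr, ← h2] at h1
    simpa using h1
  have he : ⇑d.emb = d'.emb := (d.emb.strictMono.range_inj d'.emb.strictMono).1 hr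
  obtain rfl : lab = lab' := by
    ext i
    have h1 := d.lab i
    have h2 := d'.lab i
    rw [he] at h1
    exact h1.symm.trans h2
  congr
  exact Coface.ext (DFunLike.coe_injective he) hA hB

namespace IPoset

/-- A set of pairwise `<`-incomparable elements is a lo-set. -/
theorem exists_loSet (P : IPoset Act) (A : Set P.carrier)
    (hA : ∀ x ∈ A, ∀ y ∈ A, ¬ P.prec x y) :
    ∃ (U : LoSet Act) (e : Fin U.n ≃ A), (∀ i j, i < j ↔ P.evo (e i) (e j)) ∧
      ∀ i, P.lab (e i) = U.lab i := by
  classical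
  have := P.finite
  have hST : IsStrictTotalOrder A (fun x y => P.evo x y) :=
    { trichotomous := fun x y h1 h2 => by
        rcases P.comparable x y with h | h | h | h | h
        · exact Subtype.ext h
        · exact absurd h (hA _ x.2 _ y.2)
        · exact absurd h (hA _ y.2 _ x.2)
        · exact absurd h h1
        · exact absurd h h2
      irrefl := fun x => P.evo_irrefl _
      trans := fun x y z => P.evo_trans _ _ _ }
  let _ : LinearOrder A := linearOrderOfSTO (fun x y => P.evo x y)
  let _ := Fintype.ofFinite A
  let e := Fintype.orderIsoFinOfCardEq A rfl
  exact ⟨⟨_, fun i => P.lab (e i)⟩, e.toEquiv, fun i j => e.lt_iff_lt.symm, fun i => rfl⟩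

theorem exists_arrow (P : IPoset Act) :
    ∃ (U V : LoSet Act) (p : IPosetArrow U V), p.P = P := by
  obtain ⟨U, e, h1, h2⟩ := P.exists_loSet P.S (fun x _ y hy => P.S_minimal y hy x)
  obtain ⟨V, e', h1', h2'⟩ := P.exists_loSet P.T (fun x hx y _ => P.T_maximal x hx y)
  exact ⟨U, V, ⟨P, e, h1, h2, e', h1', h2'⟩, rfl⟩

/-- The parametrisation of `T_P`, transported along `f`, is taken as the parametrisation of `S_Q`;
then the composite of arrows glues along `f` itself. -/
theorem exists_arrows_glue (P Q : IPoset Act) (f : InterfaceIso P Q) :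
    ∃ (U V W : LoSet Act) (p : IPosetArrow U V) (q : IPosetArrow V W), p.P = P ∧ q.P = Q ∧
      (p.comp q).P = glue P Q f := by
  obtain ⟨U, e, h1, h2⟩ := P.exists_loSet P.S (fun x _ y hy => P.S_minimal y hy x)
  obtain ⟨V, e', h1', h2'⟩ := P.exists_loSet P.T (fun x hx y _ => P.T_maximal x hx y)
  obtain ⟨W, e'', h1'', h2''⟩ := Q.exists_loSet Q.T (fun x hx y _ => Q.T_maximal x hx y)
  refine ⟨U, V, W, ⟨P, e, h1, h2, e', h1', h2'⟩, ⟨Q, e'.trans f.toEquiv,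
    fun i j => (h1' i j).trans (f.evo_iff _ _), fun i => (f.lab_eq _).trans (h2' i),
    e'', h1'', h2''⟩, rfl, rfl, ?_⟩
  have : f = ⟨e'.symm.trans (e'.trans f.toEquiv), by simpa using f.evo_iff,
      by simpa using f.lab_eq⟩ := by
    obtain ⟨f, _, _⟩ := f
    congr
    ext
    simp
  exact congrArg (glue P Q) this.symm

end IPoset

namespace IPosetArrow

variable {U V U' V' : LoSet Act}

/-- A subsumption restricts to an isomorphism of source interfaces, which skeletality turns into an
equality of objects, so that arrows can be composed. -/
theorem src_eq_of_subsumption {p : IPosetArrow U V} {q : IPosetArrow U' V'}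
    (f : Nonempty (IPoset.Subsumption p.P q.P)) : U = U' := by
  obtain ⟨f⟩ := f
  let e : p.P.S ≃ q.P.S := (f.toEquiv.image p.P.S).trans (Equiv.setCongr f.map_S)
  have he : ∀ x, (e x).1 = f.toEquiv x := fun x => rfl
  refine LoSet.eq_of_equiv ((p.src.trans e).trans q.src.symm) (fun i j hij => ?_) (fun i => ?_)
  · rw [q.src_evo]
    simp only [Equiv.trans_apply, Equiv.apply_symm_apply, he]
    exact f.map_evo _ _ ((p.src_evo _ _).1 hij) (p.P.S_minimal _ (p.src_mem _) _)
      (p.P.S_minimal _ (p.src_mem _) _)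
  · rw [← q.src_lab]
    simp only [Equiv.trans_apply, Equiv.apply_symm_apply, he]
    rw [f.map_lab, p.src_lab]

theorem tgt_eq_of_subsumption {p : IPosetArrow U V} {q : IPosetArrow U' V'}
    (f : Nonempty (IPoset.Subsumption p.P q.P)) : V = V' := by
  obtain ⟨f⟩ := f
  let e : p.P.T ≃ q.P.T := (f.toEquiv.image p.P.T).trans (Equiv.setCongr f.map_T)
  have he : ∀ x, (e x).1 = f.toEquiv x := fun x => rfl
  refine LoSet.eq_of_equiv ((p.tgt.trans e).trans q.tgt.symm) (fun i j hij => ?_) (fun i => ?_)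
  · rw [q.tgt_evo]
    simp only [Equiv.trans_apply, Equiv.apply_symm_apply, he]
    exact f.map_evo _ _ ((p.tgt_evo _ _).1 hij) (p.P.T_maximal _ (p.tgt_mem _) _)
      (p.P.T_maximal _ (p.tgt_mem _) _)
  · rw [← q.tgt_lab]
    simp only [Equiv.trans_apply, Equiv.apply_symm_apply, he]
    rw [f.map_lab, p.tgt_lab]

end IPosetArrow

/-! ### The Kleene plus in terms of runs -/

section KleenePlus

/-- The ipomsets of paths from a start cell to an accept cell. -/
def pathLang {C : Type v} [Category.{w} C] (F : C ⥤ LoSet Act) (X : Cᵒᵖ ⥤ Type w')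
    (start accept : ∀ U : C, Set (X.obj (op U))) : Set (Ipomset Act) :=
  {P | ∃ (U V : C) (x : X.obj (op U)) (y : X.obj (op V)) (p : Path F X x y),
    x ∈ start U ∧ y ∈ accept V ∧ P = Ipomset.mk p.ev.P}

variable {C : Type v} [Category.{w} C] (F : C ⥤ LoSet Act) (X : Cᵒᵖ ⥤ Type w')
  (start accept : ∀ U : C, Set (X.obj (op U)))

/-- The transition graph of the cells of `X`, with silent edges from accept cells to start cells
with the same events. -/
abbrev loopGraph : StepGraph.{u, max v w'} Act where
  N := Σ U : C, X.obj (op U)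
  ob c := F.obj c.1
  up x y d := ∃ f : x.1 ⟶ y.1, F.map f = d ∧ (F.map f : Coface _ _).B = ∅ ∧ X.map f.op y.2 = x.2
  down x y d := ∃ f : y.1 ⟶ x.1, F.map f = d ∧ (F.map f : Coface _ _).A = ∅ ∧ X.map f.op x.2 = y.2
  -- Only the underlying lo-sets have to agree: with interfaces present, an accept cell and a start
  -- cell with the same events may be decorated differently.
  silent x y := x.2 ∈ accept x.1 ∧ y.2 ∈ start y.1 ∧ F.obj x.1 = F.obj y.1

theorem ob_eq_of_silent (x y : (loopGraph F X start accept).N)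
    (h : (loopGraph F X start accept).silent x y) :
    (loopGraph F X start accept).ob x = (loopGraph F X start accept).ob y := h.2.2

variable {F X}

/-- Stating this with a run to continue with lets the same induction serve both a lone path and a
path followed by a silent edge. Reassociation costs an isomorphism. -/
theorem Path.exists_run {U V : C} {x : X.obj (op U)} {y : X.obj (op V)} (p : Path F X x y)
    {z : Σ U : C, X.obj (op U)} {W : LoSet Act} {q : IPosetArrow (F.obj V) W}
    (h : (loopGraph F X start accept).Run ⟨V, y⟩ z q) :
    ∃ r : IPosetArrow (F.obj U) W, (loopGraph F X start accept).Run ⟨U, x⟩ z r ∧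
      r.P ≈ (p.ev.comp q).P := by
  induction p with
  | nil x => exact ⟨q, h, Setoid.symm (IPosetArrow.id_comp q)⟩
  | @up U V _ x y z d hB hx p ih =>
    obtain ⟨r, hr, e⟩ := ih h
    exact ⟨_, StepGraph.Run.up (G := loopGraph F X start accept) (x := ⟨U, x⟩) (y := ⟨V, y⟩)
      ⟨d, rfl, hB, hx⟩ hr, Setoid.trans (IPosetArrow.comp_congr (Setoid.refl _) e)
      (Setoid.symm (IPosetArrow.comp_assoc _ _ _))⟩
  | @down U V _ x y z d hB hx p ih =>
    obtain ⟨r, hr, e⟩ := ih h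
    exact ⟨_, StepGraph.Run.down (G := loopGraph F X start accept) (x := ⟨U, x⟩) (y := ⟨V, y⟩)
      ⟨d, rfl, hB, hx⟩ hr, Setoid.trans (IPosetArrow.comp_congr (Setoid.refl _) e)
      (Setoid.symm (IPosetArrow.comp_assoc _ _ _))⟩

variable {start accept} {L : IpomsetLanguage Act}

theorem IpomsetLanguage.mk_comp_mem_powSucc {U V W : LoSet Act} {p : IPosetArrow U V}
    {q : IPosetArrow V W} {n : ℕ} (hp : Ipomset.mk p.P ∈ L.carrier)
    (hq : Ipomset.mk q.P ∈ (L.powSucc n).carrier) :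
    Ipomset.mk (p.comp q).P ∈ (L.powSucc (n + 1)).carrier :=
  ⟨(IPosetArrow.compGluing p q).isInterval (L.interval _ hp) ((L.powSucc n).interval _ hq),
    _, ⟨p.P, q.P, p.interfaceIso q, hp, hq, rfl⟩, ⟨IPoset.Subsumption.refl _⟩⟩

/-- The two alternatives are the shapes left by `StepGraph.Run.exists_path`: a single path, giving
the first power, or a path followed by an element of some power. -/
theorem mk_mem_powSucc_of_path
    (hL : L.carrier = pathLang F X start accept) {U V : C} {x : X.obj (op U)} {y : X.obj (op V)} {W Z : LoSet Act}
    {q : IPosetArrow W Z} (hx : x ∈ start U) (hy : y ∈ accept V) (p : Path F X x y)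
    (h : q.P ≈ p.ev.P ∨ ∃ (Q : IPosetArrow (F.obj V) Z) (n : ℕ),
      Ipomset.mk Q.P ∈ (L.powSucc n).carrier ∧ q.P ≈ (p.ev.comp Q).P) :
    ∃ n, Ipomset.mk q.P ∈ (L.powSucc n).carrier := by
  have hp : Ipomset.mk p.ev.P ∈ L.carrier := hL ▸ ⟨U, V, x, y, p, hx, hy, rfl⟩
  rcases h with h | ⟨Q, n, hQ, h⟩
  · have e : Ipomset.mk q.P = Ipomset.mk p.ev.P := Quotient.sound h
    rw [e]
    exact ⟨0, hp⟩
  · have e : Ipomset.mk q.P = Ipomset.mk (p.ev.comp Q).P := Quotient.sound h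
    rw [e]
    exact ⟨n + 1, IpomsetLanguage.mk_comp_mem_powSucc hp hQ⟩

/-- The run is peeled at its first silent edge: what precedes it is a path to an accept cell, and
what follows begins at a start cell and is, inductively, in some power of `L`. -/
theorem StepGraph.Run.exists_path
    (hL : L.carrier = pathLang F X start accept) {x z : (loopGraph F X start accept).N} {U V : LoSet Act}
    {q : IPosetArrow U V} (h : (loopGraph F X start accept).Run x z q) (hz : z.2 ∈ accept z.1) :
    ∃ y : Σ U : C, X.obj (op U), y.2 ∈ accept y.1 ∧ ∃ p : Path F X x.2 y.2, q.P ≈ p.ev.P ∨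
      ∃ (Q : IPosetArrow (F.obj y.1) V) (n : ℕ), Ipomset.mk Q.P ∈ (L.powSucc n).carrier ∧
        q.P ≈ (p.ev.comp Q).P := by
  induction h with
  | nil x => exact ⟨x, hz, .nil _, Or.inl (Setoid.refl _)⟩
  | up hd _ ih =>
    obtain ⟨f, rfl, hB, hx⟩ := hd
    obtain ⟨y, hy, p, h⟩ := ih hz
    refine ⟨y, hy, .up f hB hx p, ?_⟩
    rcases h with h | ⟨Q, n, hQ, h⟩
    · exact Or.inl (IPosetArrow.comp_congr (Setoid.refl _) h)
    · exact Or.inr ⟨Q, n, hQ, Setoid.trans (IPosetArrow.comp_congr (Setoid.refl _) h)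
        (Setoid.symm (IPosetArrow.comp_assoc _ _ _))⟩
  | down hd _ ih =>
    obtain ⟨f, rfl, hB, hx⟩ := hd
    obtain ⟨y, hy, p, h⟩ := ih hz
    refine ⟨y, hy, .down f hB hx p, ?_⟩
    rcases h with h | ⟨Q, n, hQ, h⟩
    · exact Or.inl (IPosetArrow.comp_congr (Setoid.refl _) h)
    · exact Or.inr ⟨Q, n, hQ, Setoid.trans (IPosetArrow.comp_congr (Setoid.refl _) h)
        (Setoid.symm (IPosetArrow.comp_assoc _ _ _))⟩
  | @silent x y z U V q hs hq ih =>
    obtain ⟨hx, hy, hxy⟩ := hs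
    obtain ⟨y', hy', p, h⟩ := ih hz
    obtain ⟨n, hn⟩ := mk_mem_powSucc_of_path hL hy hy' p h
    have hU : U = F.obj x.1 := (hq.ob_eq (ob_eq_of_silent F X start accept)).1.trans hxy.symm
    subst hU
    exact ⟨x, hx, .nil _, Or.inr ⟨q, n, hn, Setoid.symm (IPosetArrow.id_comp q)⟩⟩

/-- The acceptance condition of the graph of cells with silent edges. -/
abbrev LoopAccepts (F : C ⥤ LoSet Act) (X : Cᵒᵖ ⥤ Type w')
    (start accept : ∀ U : C, Set (X.obj (op U))) (P : IPoset Act) : Prop :=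
  (loopGraph F X start accept).Accepts {x | x.2 ∈ start x.1} {x | x.2 ∈ accept x.1} P

/-- Factors are chained by silent edges. The down-closure taken at every gluing is absorbed because
acceptance is defined up to subsumption and gluing is monotone. -/
theorem loopAccepts_of_mem_powSucc
    (hL : L.carrier = pathLang F X start accept) (n : ℕ) : ∀ P : IPoset Act,
    Ipomset.mk P ∈ (L.powSucc n).carrier → LoopAccepts F X start accept P := by
  induction n with
  | zero =>
    intro P hP
    obtain ⟨U, V, x, y, p, hx, hy, h⟩ : Ipomset.mk P ∈ pathLang _ _ _ _ := hL ▸ hP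
    obtain ⟨r, hr, e⟩ := p.exists_run start accept (.nil _)
    have h' : P ≈ r.P := Setoid.trans (Quotient.exact h)
      (Setoid.symm (Setoid.trans e (IPosetArrow.comp_id _)))
    exact ⟨⟨U, x⟩, hx, ⟨V, y⟩, hy, _, _, r, hr, IPoset.subsumption_of_equiv h'⟩
  | succ n ih =>
    rintro P ⟨-, _, ⟨P₁, Q₁, f, hP, hQ, rfl⟩, hPQ⟩
    obtain ⟨⟨y', y⟩, hy, z, hz, U', W', r, hr, hQr⟩ := ih _ hQ
    obtain ⟨U, V, x, y, p, hx, hy', h⟩ : Ipomset.mk P₁ ∈ pathLang _ _ _ _ := hL ▸ hP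
    obtain ⟨U₁, V₁, W₁, p₁, q₁, rfl, rfl, hpq⟩ := P₁.exists_arrows_glue Q₁ f
    have hp₁ := IPoset.subsumption_of_equiv (Quotient.exact h)
    obtain rfl := IPosetArrow.tgt_eq_of_subsumption hp₁
    obtain rfl := IPosetArrow.src_eq_of_subsumption hQr
    obtain ⟨r', hr', e⟩ := p.exists_run start accept (StepGraph.Run.silent
      (G := loopGraph F X start accept) (x := ⟨V, y⟩)
      ⟨hy', hy, (hr.ob_eq (ob_eq_of_silent F X start accept)).1⟩ hr)
    obtain ⟨g₁⟩ : Nonempty (IPoset.Subsumption P (IPoset.glue p₁.P q₁.P f)) := hPQ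
    obtain ⟨g₂⟩ := IPosetArrow.comp_mono hp₁ hQr
    obtain ⟨g₃⟩ := IPoset.subsumption_of_equiv (Setoid.symm e)
    rw [← hpq] at g₁
    exact ⟨⟨U, x⟩, hx, z, hz, _, _, r', hr', ⟨(g₁.trans g₂).trans g₃⟩⟩

/-- Membership in the Kleene plus. -/
theorem mk_mem_kleenePlus_iff (hL : L.carrier = pathLang F X start accept)
    (P : IPoset Act) :
    Ipomset.mk P ∈ L.kleenePlus.carrier ↔ P.IsInterval ∧ LoopAccepts F X start accept P := by
  constructor
  · intro h
    obtain ⟨n, hn⟩ := Set.mem_iUnion.1 h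
    exact ⟨L.kleenePlus.interval _ h, loopAccepts_of_mem_powSucc hL n P hn⟩
  · rintro ⟨hP, x, hx, z, hz, U, V, r, hr, f⟩
    obtain ⟨y, hy, p, h⟩ := StepGraph.Run.exists_path hL hr hz
    obtain ⟨n, hn⟩ := mk_mem_powSucc_of_path hL hx hy p h
    exact Set.mem_iUnion.2 ⟨n, (L.powSucc n).down_closed (Ipomset.mk P) (Ipomset.mk r.P) hP f hn⟩

end KleenePlus

/-! ### Faces of arrows -/

namespace Coface

variable {U V W : LoSet Act}

theorem mem_or_mem (d : Coface U V) (i : Fin V.n) :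
    (i ∈ d.A ∨ i ∈ d.B) ↔ ¬ ∃ j, d.emb j = i := by
  simpa using Set.ext_iff.1 d.union i

theorem emb_notMem_A (d : Coface U V) (j : Fin U.n) : d.emb j ∉ d.A :=
  fun h => (d.mem_or_mem _).1 (Or.inl h) ⟨j, rfl⟩

theorem emb_notMem_B (d : Coface U V) (j : Fin U.n) : d.emb j ∉ d.B :=
  fun h => (d.mem_or_mem _).1 (Or.inr h) ⟨j, rfl⟩

theorem mem_A_of_B_eq_empty {d : Coface U V} (h : d.B = ∅) {i : Fin V.n}
    (hi : ¬ ∃ j, d.emb j = i) : i ∈ d.A :=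
  ((d.mem_or_mem i).2 hi).resolve_right (by simp [h])

end Coface

namespace IPosetArrow

variable {U V W V' V'' : LoSet Act}

/-- The events unstarted by `d` are not source events. -/
def Avoids (p : IPosetArrow U V) (d : Coface V' V) : Prop := ∀ i ∈ d.A, (p.tgt i).1 ∉ p.P.S

/-- Removing the target events unstarted by `d`, and ending those terminated by `d`. -/
noncomputable def face (p : IPosetArrow U V) (d : Coface V' V) (h : p.Avoids d) :
    IPosetArrow U V' where
  P :=
    { carrier := {x : p.P.carrier // ∀ i ∈ d.A, x ≠ p.tgt i}
      finite := by
        have := p.P.finite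
        infer_instance
      prec x y := p.P.prec x y
      evo x y := p.P.evo x y
      S := {x | x.1 ∈ p.P.S}
      T := {x | ∃ j, p.tgt (d.emb j) = x.1}
      lab x := p.P.lab x
      prec_irrefl x := p.P.prec_irrefl x
      prec_trans x y z := p.P.prec_trans x y z
      evo_irrefl x := p.P.evo_irrefl x
      evo_trans x y z := p.P.evo_trans x y z
      comparable x y := by
        rw [Subtype.ext_iff]
        exact p.P.comparable x y
      S_minimal x hx y := p.P.S_minimal x hx y
      T_maximal := by
        rintro x ⟨j, hj⟩ y
        rw [← hj]
        exact p.P.T_maximal _ (p.tgt_mem _) _ }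
  src := Equiv.ofBijective (fun i => ⟨⟨p.src i, fun j hj hij => h j hj (hij ▸ p.src_mem i)⟩,
      p.src_mem i⟩) ⟨fun i j hij => p.src_inj (congrArg (fun x => x.1.1) hij), by
    rintro ⟨⟨x, hx⟩, hxS⟩
    obtain ⟨i, rfl⟩ := p.exists_src hxS
    exact ⟨i, rfl⟩⟩
  src_evo := p.src_evo
  src_lab := p.src_lab
  tgt := Equiv.ofBijective (fun j => ⟨⟨p.tgt (d.emb j), fun i hi hij =>
      d.emb_notMem_A j (p.tgt_inj hij ▸ hi)⟩, j, rfl⟩)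
    ⟨fun i j hij => d.emb.injective (p.tgt_inj (congrArg (fun x => x.1.1) hij)), by
    rintro ⟨x, j, hj⟩
    exact ⟨j, Subtype.ext (Subtype.ext hj)⟩⟩
  tgt_evo i j := d.emb.lt_iff_lt.symm.trans (p.tgt_evo _ _)
  tgt_lab i := (p.tgt_lab _).trans (d.lab i)

theorem face_isInterval {p : IPosetArrow U V} {d : Coface V' V} (h : p.Avoids d)
    (hp : p.P.IsInterval) : (p.face d h).P.IsInterval := by
  obtain ⟨b, e, hbe, h'⟩ := hp
  exact ⟨fun x => b x.1, fun x => e x.1, fun x => hbe _, fun x y => h' _ _⟩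

theorem avoids_comp {p : IPosetArrow U V} {d : Coface V' V} {b : Coface V'' V'} :
    p.Avoids (b.comp d) ↔ ∃ h : p.Avoids d, (p.face d h).Avoids b := by
  constructor
  · intro h
    exact ⟨fun i hi => h i (Or.inr hi), fun i hi => h _ (Or.inl ⟨i, hi, rfl⟩)⟩
  · rintro ⟨h, h'⟩ i (⟨j, hj, rfl⟩ | hi)
    · exact h' j hj
    · exact h i hi

theorem avoids_of_A_eq_empty (p : IPosetArrow U V) {d : Coface V' V} (h : d.A = ∅) :
    p.Avoids d := fun i hi => absurd hi (by simp [h])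

/-- The precubical identity for prefixes. It holds only up to isomorphism, the carriers being
iterated subtypes, but quotients do not see the difference. -/
theorem face_face {p : IPosetArrow U V} {d : Coface V' V} {b : Coface V'' V'}
    (h : p.Avoids d) (h' : (p.face d h).Avoids b) (h'' : p.Avoids (b.comp d)) :
    ((p.face d h).face b h').P ≈ (p.face (b.comp d) h'').P := by
  refine ⟨⟨⟨⟨fun x => ⟨x.1.1, ?_⟩, fun x => ⟨⟨x.1, ?_⟩, ?_⟩, fun x => rfl, fun x => rfl⟩,
    ?_, ?_, fun x => rfl, fun x y h => h, fun x y h _ _ => h⟩, fun x y h => h⟩⟩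
  · rintro i (⟨j, hj, rfl⟩ | hi) hx
    · exact x.2 j hj (Subtype.ext hx)
    · exact x.1.2 i hi hx
  · exact fun i hi => x.2 i (Or.inr hi)
  · exact fun i hi hx => x.2 _ (Or.inl ⟨i, hi, rfl⟩) (congrArg Subtype.val hx)
  · ext x
    constructor
    · rintro ⟨y, hy, rfl⟩
      exact hy
    · intro hx
      exact ⟨_, hx, Equiv.apply_symm_apply _ x⟩
  · ext x
    constructor
    · rintro ⟨y, ⟨j, hj⟩, rfl⟩
      exact ⟨j, congrArg Subtype.val hj⟩
    · rintro ⟨j, hj⟩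
      refine ⟨_, ⟨j, ?_⟩, Equiv.apply_symm_apply _ x⟩
      exact Subtype.ext hj

theorem face_id (p : IPosetArrow U V) (h : p.Avoids (Coface.id V)) :
    (p.face (Coface.id V) h).P ≈ p.P := by
  refine ⟨⟨⟨⟨fun x => x.1, fun x => ⟨x, fun i hi => hi.elim⟩, fun x => rfl, fun x => rfl⟩,
    ?_, ?_, fun x => rfl, fun x y h => h, fun x y h _ _ => h⟩, fun x y h => h⟩⟩
  · ext x
    constructor
    · rintro ⟨y, hy, rfl⟩
      exact hy
    · intro hx
      exact ⟨⟨x, fun i hi => hi.elim⟩, hx, rfl⟩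
  · ext x
    constructor
    · rintro ⟨y, ⟨j, hj⟩, rfl⟩
      exact Set.mem_of_eq_of_mem hj.symm (p.tgt_mem _)
    · intro hx
      obtain ⟨j, rfl⟩ := p.exists_tgt hx
      exact ⟨⟨p.tgt j, fun i hi => hi.elim⟩, ⟨j, rfl⟩, rfl⟩

/-- Terminating events is gluing with a terminator. -/
noncomputable def faceTerminator (p : IPosetArrow U V) {d : Coface V' V} (hA : d.A = ∅)
    (h : p.Avoids d) : Gluing p (IPosetArrow.terminator d) (p.face d h) where
  inl x := ⟨x, fun i hi => absurd hi (by simp [hA])⟩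
  inr i := ⟨p.tgt i, fun i hi => absurd hi (by simp [hA])⟩
  inl_injective _ _ h := Subtype.ext_iff.1 h
  inr_injective _ _ hij := p.tgt_inj (congrArg (fun x : (p.face d h).P.carrier => x.1) hij)
  inl_tgt _ := rfl
  meet _ i h := ⟨i, Subtype.ext_iff.1 h, rfl⟩
  cover z := Or.inl ⟨z.1, rfl⟩
  inl_src _ := rfl
  inr_tgt _ := rfl
  lab_inl _ := rfl
  lab_inr := p.tgt_lab
  prec_inl _ _ := Iff.rfl
  prec_inr i _ := iff_of_false (p.P.T_maximal _ (p.tgt_mem i) _) (fun h => h)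
  prec_inl_inr _ _ _ h := absurd trivial h
  evo_inl _ _ h _ _ := h
  evo_inr i j h _ _ := (p.tgt_evo i j).1 h

/-- If the events of `A` come after all terminated events, then they may be started last. -/
noncomputable def faceStarter (p : IPosetArrow U V) {d : Coface V' V} (hB : d.B = ∅)
    (h : p.Avoids d) (hp : ∀ x, x ∉ p.P.T → ∀ i ∈ d.A, p.P.prec x (p.tgt i)) :
    Gluing (p.face d h) (IPosetArrow.starter d) p where
  inl x := x.1
  inr i := p.tgt i
  inl_injective _ _ h := Subtype.ext h
  inr_injective _ _ h := p.tgt_inj h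
  inl_tgt _ := rfl
  meet := by
    rintro ⟨_, hx⟩ i rfl
    obtain ⟨j, rfl⟩ : ∃ j, d.emb j = i := by
      by_contra hi
      exact hx i (Coface.mem_A_of_B_eq_empty hB hi) rfl
    exact ⟨j, rfl, rfl⟩
  cover z := by
    by_cases hz : ∀ i ∈ d.A, z ≠ p.tgt i
    · exact Or.inl ⟨⟨z, hz⟩, rfl⟩
    · push Not at hz
      obtain ⟨i, -, rfl⟩ := hz
      exact Or.inr ⟨i, rfl⟩
  inl_src _ := rfl
  inr_tgt _ := rfl
  lab_inl _ := rfl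
  lab_inr := p.tgt_lab
  prec_inl _ _ := Iff.rfl
  prec_inr i _ := iff_of_false (p.P.T_maximal _ (p.tgt_mem i) _) (fun h => h)
  prec_inl_inr := by
    rintro ⟨x, hx⟩ i hxT hi
    refine hp x (fun h' => ?_) i (Coface.mem_A_of_B_eq_empty hB hi)
    obtain ⟨j, rfl⟩ := p.exists_tgt h'
    by_cases hj : ∃ k, d.emb k = j
    · obtain ⟨k, rfl⟩ := hj
      exact hxT ⟨k, rfl⟩
    · exact hx j (Coface.mem_A_of_B_eq_empty hB hj) rfl
  evo_inl _ _ h _ _ := h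
  evo_inr i j h _ _ := (p.tgt_evo i j).1 h

/-- Starting unstarted events again after everything else subsumes into the original. -/
theorem face_comp_starter_subsumption (p : IPosetArrow U V) {d : Coface V' V} (hB : d.B = ∅)
    (h : p.Avoids d) :
    Nonempty (IPoset.Subsumption ((p.face d h).comp (IPosetArrow.starter d)).P p.P) := by
  -- Factor `p` as `p * id` and cut at position `d`: the face is the lower part, and the starter,
  -- whose carrier is all of `V`, is an upper part of the identity because `B` is empty.
  have hl : LowerPart (p.face d h) d p :=
    { e := Subtype.val
      injective := Subtype.val_injective
      cover := fun z => by
        by_cases hz : ∀ i ∈ d.A, z ≠ p.tgt i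
        · exact Or.inl ⟨⟨z, hz⟩, rfl⟩
        · push Not at hz
          exact Or.inr hz
      avoid := fun x => x.2
      tgt := fun _ => rfl
      image_S := by
        ext x
        constructor
        · rintro ⟨y, hy, rfl⟩
          exact hy
        · intro hx
          exact ⟨⟨x, fun i hi hxi => h i hi (hxi ▸ hx)⟩, hx, rfl⟩
      lab := fun _ => rfl
      prec := fun _ _ h => h
      evo := fun _ _ h _ _ => h }
  have hu : UpperPart (IPosetArrow.starter d) d (IPosetArrow.id V) :=
    { e := _root_.id
      injective := Function.injective_id
      cover := fun z => Or.inl ⟨z, rfl⟩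
      avoid := fun x i hi => absurd hi (by simp [hB])
      src := fun _ => rfl
      image_T := Set.image_id _
      lab := fun _ => rfl
      prec := fun _ _ h => h
      evo := fun _ _ h _ _ => h }
  obtain ⟨f⟩ := hl.comp_subsumption hu
  obtain ⟨g⟩ := IPoset.subsumption_of_equiv (comp_id p)
  exact ⟨f.trans g⟩

end IPosetArrow

/-! ### Quotients of families of iposets -/

/-- Sequences of composable starters and terminators. -/
inductive Word : LoSet Act → LoSet Act → Type u
  | nil (U : LoSet Act) : Word U U
  | up {U V W : LoSet Act} (d : Coface U V) (w : Word V W) : Word U W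
  | down {U V W : LoSet Act} (d : Coface V U) (w : Word V W) : Word U W

/-- The ipomset of a word. -/
noncomputable def Word.ev : ∀ {U V : LoSet Act}, Word U V → IPosetArrow U V
  | _, _, .nil U => IPosetArrow.id U
  | _, _, .up d w => (IPosetArrow.starter d).comp w.ev
  | _, _, .down d w => (IPosetArrow.terminator d).comp w.ev

section Quotients

variable (good : IPoset Act → Prop)

/-- The quotient of `good` by the prefix `p`. -/
def quot {U V : LoSet Act} (p : IPosetArrow U V) : Set (Σ W, Word V W) :=
  {w | good (p.comp w.2.ev).P}

/-- A family of iposets which is closed under subsumption and has finitely many quotients, of which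
only finitely many are by prefixes with a completion. -/
structure FiniteQuotients : Prop where
  mono : ∀ P Q, Nonempty (IPoset.Subsumption P Q) → good Q → good P
  finite_quot : ∀ V : LoSet Act,
    (Set.range fun p : Σ U, IPosetArrow U V => quot good p.2).Finite
  finite_support :
    {V : LoSet Act | ∃ (U : LoSet Act) (p : IPosetArrow U V), (quot good p).Nonempty}.Finite

/-- Each quotient is the value of `Φ` at the set of reachable positions, and there are finitely many
such sets. A nonempty quotient at `V` provides a coface map from `V` into a node, which bounds the
support. -/
theorem StepGraph.finiteQuotients (G : StepGraph.{u, v} Act) [Finite G.N] (start accept : Set G.N) :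
    FiniteQuotients (G.Accepts start accept) where
  mono _ _ f h := h.of_subsumption f
  finite_quot V := by
    have hV : ∀ z, Finite (Coface V (G.ob z)) := fun z =>
      have := finite_coface (G.ob z)
      Finite.of_injective (β := Σ V, Coface V (G.ob z)) (fun d => ⟨V, d⟩)
        (fun d e h => eq_of_heq (Sigma.mk.inj h).2)
    let Φ : Set (Σ z, Coface V (G.ob z)) → Set (Σ W, Word V W) := fun R => {w | ∃ c ∈ R,
      ∃ y ∈ accept, ∃ (W' : LoSet Act) (b : IPosetArrow (G.ob c.1) W'), G.Run c.1 y b ∧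
        Nonempty (IPosetArrow.UpperPart w.2.ev c.2 b)}
    refine (Set.finite_range Φ).subset ?_
    rintro _ ⟨⟨U, p⟩, rfl⟩
    refine ⟨G.reach start p, ?_⟩
    ext w
    exact (G.accepts_comp_iff start accept p w.2.ev).symm
  finite_support := by
    have := fun z => finite_coface (G.ob z)
    refine (Set.finite_range fun c : Σ z, Σ V, Coface V (G.ob z) => c.2.1).subset ?_
    rintro V ⟨U, p, w, hw⟩
    obtain ⟨⟨z, d⟩, -⟩ := (G.accepts_comp_iff start accept p w.2.ev).1 hw
    exact ⟨⟨z, V, d⟩, rfl⟩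

variable {good}

theorem FiniteQuotients.congr (hg : FiniteQuotients good) {P Q : IPoset Act} (h : P ≈ Q) :
    good P ↔ good Q :=
  ⟨hg.mono _ _ (IPoset.subsumption_of_equiv (Setoid.symm h)),
    hg.mono _ _ (IPoset.subsumption_of_equiv h)⟩

theorem FiniteQuotients.quot_congr (hg : FiniteQuotients good) {U U' V : LoSet Act}
    {p : IPosetArrow U V} {p' : IPosetArrow U' V} (h : p.P ≈ p'.P) :
    quot good p = quot good p' := by
  ext w
  exact hg.congr (IPosetArrow.comp_congr h (Setoid.refl _))

theorem FiniteQuotients.quot_subset (hg : FiniteQuotients good) {U U' V : LoSet Act}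
    {p : IPosetArrow U V} {p' : IPosetArrow U' V}
    (h : Nonempty (IPoset.Subsumption p.P p'.P)) : quot good p' ⊆ quot good p :=
  fun _ hw => hg.mono _ _ (IPosetArrow.comp_mono h ⟨IPoset.Subsumption.refl _⟩) hw

theorem FiniteQuotients.mem_quot_comp (hg : FiniteQuotients good) {U V W Z : LoSet Act}
    {p : IPosetArrow U V} {q : IPosetArrow V W} {w : Word W Z} :
    (⟨Z, w⟩ : Σ Z, Word W Z) ∈ quot good (p.comp q) ↔ good (p.comp (q.comp w.ev)).P :=
  hg.congr (IPosetArrow.comp_assoc _ _ _)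

variable (good)

/-- The quotients by the faces of `p`; the faces that unstart source events do not exist, and
their quotients are taken to be everything. -/
def faceQuot {U V V' : LoSet Act} (p : IPosetArrow U V) (d : Coface V' V) : Set (Σ W, Word V' W) :=
  {w | ∀ h : p.Avoids d, w ∈ quot good (p.face d h)}

/-- A cell of the quotient automaton: a family of quotients indexed by the faces. -/
@[ext]
structure QuotCell (U : LoSet Act) where
  s : ∀ V : LoSet Act, Coface V U → Set (Σ W, Word V W)
  -- `support` and `values` are there for finiteness, `down` and `up` for soundness.
  support : ∃ V : LoSet Act, (∃ (U' : LoSet Act) (p : IPosetArrow U' V),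
    (quot good p).Nonempty) ∧ Nonempty (Coface U V)
  values : ∀ (V : LoSet Act) (d : Coface V U),
    s V d ∈ (Set.range fun p : Σ U, IPosetArrow U V => quot good p.2) ∪ {Set.univ}
  -- Terminating is gluing with a terminator, hence an equivalence. Unstarting forgets order;
  -- restarting the events last can only add order, so `up` is one-directional.
  down : ∀ (V W : LoSet Act) (d : Coface V U) (b : Coface W V), b.A = ∅ → ∀ w,
    w ∈ s W (b.comp d) ↔ ⟨w.1, .down b w.2⟩ ∈ s V d
  up : ∀ (V W : LoSet Act) (d : Coface V U) (a : Coface W V), a.B = ∅ → ∀ w,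
    w ∈ s V d → ⟨w.1, .up a w.2⟩ ∈ s W (a.comp d)

variable {good}

/-- The face of a cell. -/
def QuotCell.restrict {U V : LoSet Act} (f : Coface U V) (c : QuotCell good V) :
    QuotCell good U where
  s W d := c.s W (d.comp f)
  support := by
    obtain ⟨Z, hZ, ⟨d⟩⟩ := c.support
    exact ⟨Z, hZ, ⟨f.comp d⟩⟩
  values W d := c.values W _
  down W Z d b hb w := by
    rw [Coface.assoc]
    exact c.down W Z _ b hb w
  up W Z d a ha w hw := by
    rw [Coface.assoc]
    exact c.up W Z _ a ha w hw

/-- `support` leaves finitely many base objects, each with finitely many faces, and `values` leaves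
finitely many choices at each face. -/
theorem FiniteQuotients.finite_quotCell (hg : FiniteQuotients good) :
    Finite (Σ U : LoSet Act, QuotCell good U) := by
  let 𝒰 := {V : LoSet Act | ∃ (U : LoSet Act) (p : IPosetArrow U V), (quot good p).Nonempty}
  have : Finite 𝒰 := hg.finite_support
  have : ∀ U : LoSet Act, Finite (Σ V, Coface V U) := finite_coface
  let 𝒱 := Set.range fun c : Σ V : 𝒰, Σ U, Coface U V.1 => c.2.1
  let 𝒬 : ∀ V : LoSet Act, Set (Set (Σ W, Word V W)) := fun V =>
    (Set.range fun p : Σ U, IPosetArrow U V => quot good p.2) ∪ {Set.univ}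
  have : ∀ V, Finite (𝒬 V) := fun V => (hg.finite_quot V).union (Set.finite_singleton _)
  have hV : ∀ U, QuotCell good U → U ∈ 𝒱 := by
    intro U c
    obtain ⟨V, hV, ⟨d⟩⟩ := c.support
    exact ⟨⟨⟨V, hV⟩, U, d⟩, rfl⟩
  refine Finite.of_injective (β := Σ U : 𝒱, ∀ c : Σ V, Coface V U.1, 𝒬 c.1)
    (fun c => ⟨⟨c.1, hV _ c.2⟩, fun d => ⟨c.2.s d.1 d.2, c.2.values d.1 d.2⟩⟩) ?_
  rintro ⟨U, c⟩ ⟨U', c'⟩ h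
  obtain rfl : U = U' := congrArg (fun x => x.1.1) h
  have h' := eq_of_heq (Sigma.mk.inj h).2
  congr
  apply QuotCell.ext
  funext V d
  exact congrArg Subtype.val (congrFun h' ⟨V, d⟩)

end Quotients

theorem exists_coface (V : LoSet Act) (A B : Set (Fin V.n)) (h : Disjoint A B) :
    ∃ (V' : LoSet Act) (d : Coface V' V), d.A = A ∧ d.B = B := by
  classical
  let s : Finset (Fin V.n) := ((A ∪ B)ᶜ).toFinset
  let f := s.orderEmbOfFin rfl
  refine ⟨⟨s.card, fun i => V.lab (f i)⟩, ⟨f, A, B, fun i => rfl, h, ?_⟩, rfl, rfl⟩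
  rw [Finset.range_orderEmbOfFin, Set.coe_toFinset, compl_compl]

/-! ### Decomposition of interval iposets -/

namespace IPosetArrow

variable {U U' V V' : LoSet Act}

theorem face_congr {p : IPosetArrow U V} {p' : IPosetArrow U' V} (e : p.P ≈ p'.P) {d : Coface V' V}
    (h : p.Avoids d) (h' : p'.Avoids d) : (p.face d h).P ≈ (p'.face d h').P := by
  obtain ⟨f⟩ := e
  have ht : ∀ i, f.toEquiv (p.tgt i) = p'.tgt i := map_tgt f.toSubsumption
  refine ⟨⟨⟨f.toEquiv.subtypeEquiv fun x => ?_, ?_, ?_, fun x => f.map_lab _,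
    fun x y h => f.reflect_prec _ _ h, fun x y h h1 h2 => f.map_evo _ _ h h1 h2⟩,
    fun x y h => f.map_prec _ _ h⟩⟩
  · refine forall₂_congr fun i _ => ?_
    rw [← ht, f.toEquiv.injective.ne_iff]
  · ext x
    constructor
    · rintro ⟨y, hy, rfl⟩
      exact f.map_S.subset ⟨_, hy, rfl⟩
    · intro hx
      obtain ⟨y, hy, hyx⟩ : x.1 ∈ f.toEquiv '' p.P.S := f.map_S.symm ▸ hx
      refine ⟨⟨y, fun i hi hyi => x.2 i hi ?_⟩, hy, Subtype.ext hyx⟩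
      rw [← hyx, hyi, ht]
  · ext x
    constructor
    · rintro ⟨y, ⟨j, hj⟩, rfl⟩
      refine ⟨j, ?_⟩
      rw [← ht, hj]
      rfl
    · rintro ⟨j, hj⟩
      refine ⟨⟨p.tgt (d.emb j), fun i hi hij => d.emb_notMem_A j (p.tgt_inj hij ▸ hi)⟩, ⟨j, rfl⟩,
        Subtype.ext ?_⟩
      exact (ht _).trans hj

theorem avoids_congr {p : IPosetArrow U V} {p' : IPosetArrow U' V} (e : p.P ≈ p'.P)
    {d : Coface V' V} (h : p.Avoids d) : p'.Avoids d := by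
  obtain ⟨f⟩ := e
  intro i hi hS
  rw [← map_tgt f.toSubsumption, ← f.map_S] at hS
  obtain ⟨y, hy, h'⟩ := hS
  rw [f.toEquiv.injective h'] at hy
  exact h i hi hy

/-- An interval iposet ends with the start of an event, or with the termination of an event, or is
an identity. -/
theorem exists_decomposition (p : IPosetArrow U V) (hp : p.P.IsInterval) :
    (∃ (V' : LoSet Act) (d : Coface V' V) (i : Fin V.n), d.B = ∅ ∧ i ∈ d.A ∧ p.Avoids d ∧
      ∀ x, x ∉ p.P.T → ∀ i ∈ d.A, p.P.prec x (p.tgt i)) ∨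
    (∃ (V' : LoSet Act) (p' : IPosetArrow U V') (d : Coface V V') (h : p'.Avoids d),
      d.A = ∅ ∧ p'.P.IsInterval ∧ p.P ≈ (p'.face d h).P ∧
      ∃ f : p'.P.carrier ≃ p.P.carrier, (∀ x, f x ∈ p.P.T → x ∈ p'.P.T) ∧
        ∃ x, x ∈ p'.P.T ∧ f x ∉ p.P.T) ∨
    p.P ≈ (IPosetArrow.id V).P := by
  obtain ⟨b, e, hbe, hbe'⟩ := hp
  -- If some target event outside the source interface follows every terminated event, its start may
  -- be taken as the last step.
  by_cases h₁ : ∃ i, (p.tgt i).1 ∉ p.P.S ∧ ∀ x, x ∉ p.P.T → p.P.prec x (p.tgt i)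
  · obtain ⟨i, hi, hx⟩ := h₁
    obtain ⟨V', d, hA, hB⟩ := exists_coface V {i} ∅ (Set.disjoint_empty _)
    refine Or.inl ⟨V', d, i, hB, by simp [hA], ?_, ?_⟩
    · intro j hj
      rw [hA] at hj
      rwa [Set.mem_singleton_iff.1 hj]
    · intro x hxT j hj
      rw [hA] at hj
      rw [Set.mem_singleton_iff.1 hj]
      exact hx x hxT
  push Not at h₁
  by_cases h₂ : (p.P.Tᶜ).Nonempty
  · have := p.P.finite
    obtain ⟨x, hxT, hx⟩ := Set.exists_max_image p.P.Tᶜ e (Set.toFinite _) h₂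
    -- The terminated event `x` with the latest end is `<`-maximal. If `x < y` with `y` terminated,
    -- then `y` would end later. If `y` is a target event, it is not a source event, so by `h₁` some
    -- terminated `z` does not precede it, although `z` ends no later than `x`.
    have hmax : ∀ y, ¬ p.P.prec x y := by
      intro y hxy
      by_cases hy : y ∈ p.P.T
      · obtain ⟨i, rfl⟩ := p.exists_tgt hy
        obtain ⟨z, hz, hzy⟩ := h₁ i (fun hS => p.P.S_minimal _ hS _ hxy)
        rw [hbe'] at hzy hxy
        exact hzy ((hx z hz).trans_lt hxy)
      · rw [hbe'] at hxy
        exact absurd (hx y hy) (not_le.2 (hxy.trans_le (hbe y)))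
    have hmax' : ∀ z ∈ insert x p.P.T, ∀ y, ¬ p.P.prec z y := by
      rintro z (rfl | hz)
      · exact hmax
      · exact p.P.T_maximal z hz
    obtain ⟨V', t, ht, ht'⟩ := p.P.exists_loSet (insert x p.P.T) (fun z hz y _ => hmax' z hz y)
    -- By maximality `x` may join the target interface; terminating it again gives back `p`.
    let p' : IPosetArrow U V' :=
      { p with
        P := { p.P with T := insert x p.P.T, T_maximal := hmax' }
        tgt := t
        tgt_evo := ht
        tgt_lab := ht' }
    obtain ⟨j, hj⟩ := p'.exists_tgt (x := x) (Set.mem_insert _ _)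
    obtain ⟨V'', d, hA, hB⟩ := exists_coface V' ∅ {j} (Set.empty_disjoint _)
    have hd : ∀ i, (∃ k, d.emb k = i) ↔ i ≠ j := by
      intro i
      have := d.mem_or_mem i
      rw [hA, hB] at this
      simp only [Set.mem_empty_iff_false, false_or, Set.mem_singleton_iff] at this
      tauto
    have h := p'.avoids_of_A_eq_empty hA
    have hiso : p.P ≈ (p'.face d h).P := by
      refine ⟨⟨⟨⟨fun z => ⟨z, fun i hi => absurd hi (by simp [hA])⟩, fun z => z.1, fun z => rfl,
        fun z => rfl⟩, ?_, ?_, fun x => rfl, fun x y h => h, fun x y h _ _ => h⟩, fun x y h => h⟩⟩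
      · ext z
        constructor
        · rintro ⟨y, hy, rfl⟩
          exact hy
        · intro hz
          exact ⟨z.1, hz, rfl⟩
      · ext z
        constructor
        · rintro ⟨y, hy, rfl⟩
          obtain ⟨i, hi⟩ := p'.exists_tgt (x := y) (Set.mem_insert_of_mem _ hy)
          obtain ⟨k, rfl⟩ := (hd i).2 (by
            rintro rfl
            rw [← hj] at hi
            exact hxT (hi ▸ hy))
          exact ⟨k, hi.symm⟩
        · rintro ⟨k, hk⟩
          refine ⟨z.1, ?_, rfl⟩
          have hz : z.1 ∈ insert x p.P.T := Set.mem_of_eq_of_mem hk.symm (p'.tgt_mem (d.emb k))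
          refine hz.resolve_left fun hzx => ?_
          refine (hd (d.emb k)).1 ⟨k, rfl⟩ (p'.tgt_inj ?_)
          exact (hk.trans hzx).trans hj
    obtain rfl : V = V'' := tgt_eq_of_subsumption (IPoset.subsumption_of_equiv hiso)
    exact Or.inr (Or.inl ⟨V', p', d, h, hA, ⟨b, e, hbe, hbe'⟩, hiso, Equiv.refl _,
      fun z hz => Set.mem_insert_of_mem _ hz, x, Set.mem_insert _ _, hxT⟩)
  · rw [Set.not_nonempty_iff_eq_empty, Set.compl_empty_iff] at h₂
    have hT : ∀ x, x ∈ p.P.T := fun x => h₂ ▸ trivial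
    -- With no terminated events, a target event outside `S` would vacuously follow all of them,
    -- contrary to `h₁`.
    have hS : ∀ x, x ∈ p.P.S := by
      intro x
      obtain ⟨i, rfl⟩ := p.exists_tgt (hT x)
      by_contra hi
      obtain ⟨z, hz, -⟩ := h₁ i hi
      exact hz (hT z)
    refine Or.inr (Or.inr (Setoid.symm ⟨⟨⟨Equiv.ofBijective (fun i => (p.tgt i).1)
      ⟨fun i j h => p.tgt_inj h, fun x => ?_⟩, ?_, ?_, p.tgt_lab, fun x y h => ?_,
      fun x y h _ _ => (p.tgt_evo _ _).1 h⟩, fun x y h => h.elim⟩⟩))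
    · obtain ⟨i, hi⟩ := p.exists_tgt (hT x)
      exact ⟨i, hi.symm⟩
    · ext x
      refine iff_of_true ?_ (hS x)
      obtain ⟨i, hi⟩ := p.exists_tgt (hT x)
      exact ⟨i, trivial, hi.symm⟩
    · ext x
      refine iff_of_true ?_ (hT x)
      obtain ⟨i, hi⟩ := p.exists_tgt (hT x)
      exact ⟨i, trivial, hi.symm⟩
    · exact absurd h (p.P.T_maximal _ (hT _) _)

end IPosetArrow

/-! ### Paths -/

theorem IPoset.discrete_isInterval (U : LoSet Act) (S T : Set (Fin U.n)) :
    (IPoset.discrete U S T).IsInterval :=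
  ⟨fun _ => 0, fun _ => 0, fun _ => le_rfl, fun _ _ => iff_of_false (fun h => h) (lt_irrefl _)⟩

section Paths

variable {C : Type v} [Category.{w} C] {F : C ⥤ LoSet Act} {X : Cᵒᵖ ⥤ Type w'}

theorem Path.ev_isInterval {U V : C} {x : X.obj (op U)} {y : X.obj (op V)} (p : Path F X x y) :
    p.ev.P.IsInterval := by
  induction p with
  | nil x => exact IPoset.discrete_isInterval _ _ _
  | up d hB hx p ih =>
    exact (IPosetArrow.compGluing _ _).isInterval (IPoset.discrete_isInterval _ _ _) ih
  | down d hB hx p ih =>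
    exact (IPosetArrow.compGluing _ _).isInterval (IPoset.discrete_isInterval _ _ _) ih

theorem Path.exists_append {U V W : C} {x : X.obj (op U)} {y : X.obj (op V)} {z : X.obj (op W)}
    (p : Path F X x y) (q : Path F X y z) : ∃ r : Path F X x z, r.ev.P ≈ (p.ev.comp q.ev).P := by
  induction p with
  | nil x => exact ⟨q, Setoid.symm (IPosetArrow.id_comp _)⟩
  | up d hB hx p ih =>
    obtain ⟨r, e⟩ := ih q
    exact ⟨.up d hB hx r, Setoid.trans (IPosetArrow.comp_congr (Setoid.refl _) e)
      (Setoid.symm (IPosetArrow.comp_assoc _ _ _))⟩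
  | down d hB hx p ih =>
    obtain ⟨r, e⟩ := ih q
    exact ⟨.down d hB hx r, Setoid.trans (IPosetArrow.comp_congr (Setoid.refl _) e)
      (Setoid.symm (IPosetArrow.comp_assoc _ _ _))⟩

end Paths

/-! ### The quotient automaton -/

section QuotientAutomaton

variable (good : IPoset Act → Prop)

/-- The precubical set of cells of the quotient automaton. -/
def quotPrecubical : (LoSet Act)ᵒᵖ ⥤ Type u where
  obj U := QuotCell good U.unop
  map f := TypeCat.ofHom fun c => QuotCell.restrict f.unop c
  map_id U := by
    refine ConcreteCategory.hom_ext _ _ fun c => ?_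
    apply QuotCell.ext
    funext V d
    exact congrArg (c.s V) d.comp_id
  map_comp f g := by
    refine ConcreteCategory.hom_ext _ _ fun c => ?_
    apply QuotCell.ext
    funext V d
    exact congrArg (c.s V) (Coface.assoc d g.unop f.unop).symm

/-- The start cells of the quotient automaton. -/
def quotStart (U : LoSet Act) : Set (QuotCell good U) :=
  -- The inclusion says that every completion promised by the cell is genuine; this is the invariant
  -- propagated along paths.
  {c | c.s U (Coface.id U) ⊆ quot good (IPosetArrow.id U)}

/-- The accept cells of the quotient automaton. -/
def quotAccept (U : LoSet Act) : Set (QuotCell good U) :=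
  {c | ⟨U, .nil U⟩ ∈ c.s U (Coface.id U)}

variable {good} (hg : FiniteQuotients good)

/-- The quotient automaton. -/
def FiniteQuotients.toHDA : HDA Act where
  X := quotPrecubical good
  finite := hg.finite_quotCell
  start := quotStart good
  accept := quotAccept good

theorem faceQuot_of_avoids {U V V' : LoSet Act} {p : IPosetArrow U V} {d : Coface V' V}
    (h : p.Avoids d) : faceQuot good p d = quot good (p.face d h) :=
  Set.ext fun _ => ⟨fun hw => hw h, fun hw _ => hw⟩

theorem faceQuot_of_not_avoids {U V V' : LoSet Act} {p : IPosetArrow U V} {d : Coface V' V}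
    (h : ¬ p.Avoids d) : faceQuot good p d = Set.univ :=
  Set.eq_univ_of_forall fun _ h' => absurd h' h

namespace FiniteQuotients

include hg

/-- If the inner face does not exist, neither does the composite one, and both sides take the
default value `Set.univ`. -/
theorem faceQuot_comp {U V V' V'' : LoSet Act} {p : IPosetArrow U V} {d : Coface V' V}
    (h : p.Avoids d) (b : Coface V'' V') :
    faceQuot good p (b.comp d) = faceQuot good (p.face d h) b := by
  by_cases h' : (p.face d h).Avoids b
  · have h'' := IPosetArrow.avoids_comp.2 ⟨h, h'⟩
    rw [faceQuot_of_avoids h', faceQuot_of_avoids h'']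
    exact hg.quot_congr (Setoid.symm (IPosetArrow.face_face h h' h''))
  · rw [faceQuot_of_not_avoids h', faceQuot_of_not_avoids]
    exact fun h'' => h' (IPosetArrow.avoids_comp.1 h'').2

theorem faceQuot_congr {U U' V V' : LoSet Act} {p : IPosetArrow U V} {p' : IPosetArrow U' V}
    (e : p.P ≈ p'.P) (d : Coface V' V) : faceQuot good p d = faceQuot good p' d := by
  by_cases h : p.Avoids d
  · rw [faceQuot_of_avoids h, faceQuot_of_avoids (IPosetArrow.avoids_congr e h)]
    exact hg.quot_congr (IPosetArrow.face_congr e _ _)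
  · rw [faceQuot_of_not_avoids h, faceQuot_of_not_avoids]
    exact fun h' => h (IPosetArrow.avoids_congr (Setoid.symm e) h')

theorem faceQuot_id {U V : LoSet Act} (p : IPosetArrow U V) :
    faceQuot good p (Coface.id V) = quot good p := by
  have h : p.Avoids (Coface.id V) := p.avoids_of_A_eq_empty rfl
  rw [faceQuot_of_avoids h]
  exact hg.quot_congr (p.face_id h)

theorem mem_quot_face_iff_down {U V V' Z : LoSet Act} {p : IPosetArrow U V} {d : Coface V' V}
    (hA : d.A = ∅) (h : p.Avoids d) {w : Word V' Z} :
    (⟨Z, w⟩ : Σ Z, Word V' Z) ∈ quot good (p.face d h) ↔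
      (⟨Z, .down d w⟩ : Σ Z, Word V Z) ∈ quot good p := by
  rw [hg.quot_congr (p.faceTerminator hA h).equiv_comp]
  exact hg.mem_quot_comp

/-- The cell of the quotient automaton given by the prefix `p`. -/
def cell {U V : LoSet Act} (p : IPosetArrow U V) (hp : (quot good p).Nonempty) :
    QuotCell good V where
  s _ d := faceQuot good p d
  support := ⟨V, ⟨U, p, hp⟩, ⟨Coface.id V⟩⟩
  values V' d := by
    by_cases h : p.Avoids d
    · rw [faceQuot_of_avoids h]
      exact Or.inl ⟨⟨U, p.face d h⟩, rfl⟩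
    · exact Or.inr (faceQuot_of_not_avoids h)
  down V' W d b hb w := by
    by_cases h : p.Avoids d
    · rw [hg.faceQuot_comp h, faceQuot_of_avoids ((p.face d h).avoids_of_A_eq_empty hb),
        faceQuot_of_avoids h]
      exact hg.mem_quot_face_iff_down hb _
    -- A nonexistent face has only nonexistent further faces, so both values are everything.
    · rw [faceQuot_of_not_avoids h, faceQuot_of_not_avoids]
      · exact iff_of_true trivial trivial
      · exact fun h' => h (IPosetArrow.avoids_comp.1 h').1
  up V' W d a ha w hw := by
    by_cases h : p.Avoids d
    · rw [hg.faceQuot_comp h]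
      intro h'
      rw [faceQuot_of_avoids h] at hw
      -- Restarting the unstarted events after everything else is subsumed by the original prefix,
      -- and quotients grow when a prefix becomes more ordered.
      exact hg.mem_quot_comp.1
        (hg.quot_subset ((p.face d h).face_comp_starter_subsumption ha h') hw)
    · rw [faceQuot_of_not_avoids]
      · trivial
      · exact fun h' => h (IPosetArrow.avoids_comp.1 h').1

theorem restrict_cell {U V V' : LoSet Act} {p : IPosetArrow U V} (hp : (quot good p).Nonempty)
    {d : Coface V' V} (h : p.Avoids d) (hp' : (quot good (p.face d h)).Nonempty) :
    (hg.cell p hp).restrict d = hg.cell (p.face d h) hp' := by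
  apply QuotCell.ext
  funext W b
  exact hg.faceQuot_comp h b

theorem cell_congr {U U' V : LoSet Act} {p : IPosetArrow U V} {p' : IPosetArrow U' V}
    (hp : (quot good p).Nonempty) (hp' : (quot good p').Nonempty) (e : p.P ≈ p'.P) :
    hg.cell p hp = hg.cell p' hp' := by
  apply QuotCell.ext
  funext W b
  exact hg.faceQuot_congr e b

/-- Soundness: what a cell promises remains a genuine completion of the ipomset read so far.
`QuotCell.up` and `QuotCell.down` are exactly what the two kinds of step require. -/
theorem quot_of_path {U V : LoSet Act} {x : (quotPrecubical good).obj (op U)}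
    {y : (quotPrecubical good).obj (op V)} (π : Path (𝟭 (LoSet Act)) (quotPrecubical good) x y) :
    ∀ {Z : LoSet Act} (p : IPosetArrow Z U), QuotCell.s x U (Coface.id U) ⊆ quot good p →
      QuotCell.s y V (Coface.id V) ⊆ quot good (p.comp π.ev) := by
  induction π with
  | nil x =>
    intro Z p h
    exact h.trans (hg.quot_congr (Setoid.symm (IPosetArrow.comp_id p))).subset
  | @up U V W x y z d hB hx π ih =>
    intro Z p h
    refine (ih (p.comp (IPosetArrow.starter d)) ?_).trans
      (hg.quot_congr (IPosetArrow.comp_assoc _ _ _)).subset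
    rintro ⟨W', w⟩ hw
    refine hg.mem_quot_comp.2 (h (a := ⟨W', .up d w⟩) ?_)
    have hs : QuotCell.s x U (Coface.id U) = QuotCell.s y U ((Coface.id U).comp d) :=
      congrArg (fun c : QuotCell good U => c.s U (Coface.id U)) hx.symm
    rw [hs, Coface.id_comp]
    have := QuotCell.up y V U (Coface.id V) d hB ⟨W', w⟩ hw
    rwa [Coface.comp_id] at this
  | @down U V W x y z d hA hy π ih =>
    intro Z p h
    refine (ih (p.comp (IPosetArrow.terminator d)) ?_).trans
      (hg.quot_congr (IPosetArrow.comp_assoc _ _ _)).subset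
    rintro ⟨W', w⟩ hw
    refine hg.mem_quot_comp.2 (h (a := ⟨W', .down d w⟩) ?_)
    have hs : QuotCell.s y V (Coface.id V) = QuotCell.s x V ((Coface.id V).comp d) :=
      congrArg (fun c : QuotCell good V => c.s V (Coface.id V)) hy.symm
    rw [hs, Coface.id_comp] at hw
    refine (QuotCell.down x U V (Coface.id U) d hA ⟨W', w⟩).1 ?_
    rwa [Coface.comp_id]

/-- Completeness, by removing the last step. The measure is the number of events plus the number of
terminated ones: undoing a start deletes an event and creates no terminated one, undoing a
termination keeps the events and decreases the second summand. -/
theorem exists_path_to_cell (n : ℕ) : ∀ {U V : LoSet Act} (p : IPosetArrow U V)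
    (hp : (quot good p).Nonempty), p.P.IsInterval →
    Nat.card p.P.carrier + Nat.card {x : p.P.carrier // x ∉ p.P.T} ≤ n →
    ∃ (W : LoSet Act) (x : (quotPrecubical good).obj (op W)), x ∈ quotStart good W ∧
      ∃ π : Path (𝟭 (LoSet Act)) (quotPrecubical good) (V := V) x (hg.cell p hp),
        π.ev.P ≈ p.P := by
  induction n using Nat.strong_induction_on with
  | _ n ih =>
    intro U V p hp hint hn
    have := p.P.finite
    rcases p.exists_decomposition hint with ⟨V', d, i, hB, hi, h, hd⟩ |
      ⟨V', p', d, h, hA, hint', e, f, hf, x, hx, hfx⟩ | e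
    · have g := p.faceStarter hB h hd
      have hp' : (quot good (p.face d h)).Nonempty := by
        obtain ⟨w, hw⟩ := hp
        rw [hg.quot_congr g.equiv_comp] at hw
        exact ⟨⟨w.1, .up d w.2⟩, hg.mem_quot_comp.1 hw⟩
      have h1 : Nat.card (p.face d h).P.carrier < Nat.card p.P.carrier :=
        Finite.card_subtype_lt (x := (p.tgt i).1) (fun h' => h' i hi rfl)
      have h2 : Nat.card {x : (p.face d h).P.carrier // x ∉ (p.face d h).P.T} ≤
          Nat.card {x : p.P.carrier // x ∉ p.P.T} := by
        refine Nat.card_le_card_of_injective (fun x => ⟨x.1.1, fun hx => ?_⟩)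
          (fun x y hxy => Subtype.ext (Subtype.ext
            (congrArg (fun z : {x : p.P.carrier // x ∉ p.P.T} => z.1) hxy)))
        obtain ⟨j, hj⟩ := p.exists_tgt hx
        refine x.2 ?_
        by_cases hk : ∃ k, d.emb k = j
        · obtain ⟨k, rfl⟩ := hk
          exact ⟨k, hj.symm⟩
        · exact absurd hj (x.1.2 j (Coface.mem_A_of_B_eq_empty hB hk))
      obtain ⟨W, x, hx, π, e⟩ := ih _ (by omega) (p.face d h) hp'
        (IPosetArrow.face_isInterval h hint) le_rfl
      obtain ⟨r, hr⟩ := π.exists_append (Path.up (V := V) d hB (hg.restrict_cell hp h hp') (.nil _))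
      exact ⟨W, x, hx, r, Setoid.trans hr (Setoid.trans
        (IPosetArrow.comp_congr e (IPosetArrow.comp_id _)) (Setoid.symm g.equiv_comp))⟩
    · have g := p'.faceTerminator hA h
      have hp'' : (quot good (p'.face d h)).Nonempty := by
        rwa [← hg.quot_congr e]
      have hp' : (quot good p').Nonempty := by
        obtain ⟨w, hw⟩ := hp''
        exact ⟨_, (hg.mem_quot_face_iff_down hA h).1 hw⟩
      have h1 : Nat.card p'.P.carrier = Nat.card p.P.carrier := Nat.card_congr f
      have h2 : Nat.card {x : p'.P.carrier // x ∉ p'.P.T} <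
          Nat.card {x : p.P.carrier // x ∉ p.P.T} := by
        have := p'.P.finite
        let j : {x : p'.P.carrier // x ∉ p'.P.T} → {x : p.P.carrier // x ∉ p.P.T} :=
          fun x => ⟨f x.1, fun hx => x.2 (hf _ hx)⟩
        have := Fintype.ofFinite {x : p.P.carrier // x ∉ p.P.T}
        have := Fintype.ofFinite {x : p'.P.carrier // x ∉ p'.P.T}
        rw [Nat.card_eq_fintype_card, Nat.card_eq_fintype_card]
        refine Fintype.card_lt_of_injective_of_notMem j (b := ⟨f x, hfx⟩)
          (fun x y hxy => Subtype.ext (f.injective (congrArg Subtype.val hxy))) ?_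
        rintro ⟨y, hy⟩
        exact y.2 (f.injective (congrArg Subtype.val hy) ▸ hx)
      obtain ⟨W, x, hx, π, e'⟩ := ih _ (by omega) p' hp' hint' le_rfl
      have hc : (hg.cell p' hp').restrict d = hg.cell p hp :=
        (hg.restrict_cell hp' h hp'').trans (hg.cell_congr hp'' hp (Setoid.symm e))
      obtain ⟨r, hr⟩ := π.exists_append (Path.down (V := V) d hA hc (.nil _))
      exact ⟨W, x, hx, r, Setoid.trans hr (Setoid.trans
        (IPosetArrow.comp_congr e' (IPosetArrow.comp_id _)) (Setoid.trans
        (Setoid.symm g.equiv_comp) (Setoid.symm e)))⟩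
    -- For an identity prefix the cell promises precisely the completions of the identity, so it is
    -- a start cell.
    · refine ⟨V, hg.cell p hp, ?_, .nil _, Setoid.symm e⟩
      exact ((hg.faceQuot_id p).trans (hg.quot_congr e)).subset

/-- The language of the quotient automaton. -/
theorem mk_mem_lang_toHDA_iff (P : IPoset Act) :
    Ipomset.mk P ∈ hg.toHDA.lang ↔ P.IsInterval ∧ good P := by
  constructor
  · rintro ⟨U, V, x, y, π, hx, hy, h⟩
    have e : P ≈ π.ev.P := Quotient.exact h
    refine ⟨Ipomset.isInterval_of_iso (Setoid.symm e).some π.ev_isInterval, (hg.congr e).2 ?_⟩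
    have := hg.quot_of_path π (IPosetArrow.id U) hx hy
    exact (hg.congr (Setoid.trans (IPosetArrow.comp_id _) (IPosetArrow.id_comp _))).1 this
  · rintro ⟨hP, hgood⟩
    obtain ⟨U, V, p, rfl⟩ := P.exists_arrow
    have hmem : (⟨V, .nil V⟩ : Σ W, Word V W) ∈ quot good p :=
      (hg.congr (IPosetArrow.comp_id p)).2 hgood
    obtain ⟨W, x, hx, π, e⟩ := hg.exists_path_to_cell _ p ⟨_, hmem⟩ hP le_rfl
    refine ⟨W, V, x, _, π, hx, ?_, Quotient.sound (Setoid.symm e)⟩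
    exact (hg.faceQuot_id p).symm.subset hmem

end FiniteQuotients

end QuotientAutomaton

/-! ### Adding interfaces -/

namespace HDA

variable (H : HDA Act)

/-- The automaton with interfaces whose cells are the cells of `H` with arbitrary interfaces. -/
def toIHDA : IHDA Act where
  X := (forgetInterfaces Act).op ⋙ H.X
  finite := by
    have := H.finite
    refine Finite.of_injective (β := Σ c : (Σ U : LoSet Act, H.X.obj (op U)),
      Set (Fin c.1.n) × Set (Fin c.1.n)) (fun c => ⟨⟨c.1.toLoSet, c.2⟩, c.1.S, c.1.T⟩) ?_
    rintro ⟨⟨U, S, T⟩, x⟩ ⟨⟨U', S', T'⟩, x'⟩ h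
    cases h
    rfl
  start U := {x | x ∈ H.start U.toLoSet ∧ U.S = Set.univ}
  accept U := {x | x ∈ H.accept U.toLoSet ∧ U.T = Set.univ}
  start_interface _ _ h := h.2
  accept_interface _ _ h := h.2

variable {H}

/-- Forgetting interfaces along a path. -/
theorem exists_path_of_toIHDA {U V : ILoSet Act} {x : H.toIHDA.X.obj (op U)}
    {y : H.toIHDA.X.obj (op V)} (p : Path (forgetInterfaces Act) H.toIHDA.X x y) :
    ∃ q : Path (𝟭 (LoSet Act)) H.X (U := U.toLoSet) (V := V.toLoSet) x y, q.ev = p.ev := by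
  induction p with
  | nil x => exact ⟨.nil _, rfl⟩
  | @up U V _ x y z d hB hx p ih =>
    obtain ⟨q, hq⟩ := ih
    refine ⟨Path.up (F := 𝟭 (LoSet Act)) (U := U.toLoSet) (V := V.toLoSet) d.toCoface hB hx q, ?_⟩
    exact congrArg (IPosetArrow.comp (IPosetArrow.starter d.toCoface)) hq
  | @down U V _ x y z d hA hy p ih =>
    obtain ⟨q, hq⟩ := ih
    refine ⟨Path.down (F := 𝟭 (LoSet Act)) (U := U.toLoSet) (V := V.toLoSet) d.toCoface hA hy q, ?_⟩
    exact congrArg (IPosetArrow.comp (IPosetArrow.terminator d.toCoface)) hq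

/-- Adding interfaces along a path: source interfaces are transported forwards and target
interfaces backwards. -/
theorem exists_path_toIHDA {U V : LoSet Act} {x : H.X.obj (op U)} {y : H.X.obj (op V)}
    (p : Path (𝟭 (LoSet Act)) H.X x y) (S : Set (Fin U.n)) (T : Set (Fin V.n)) :
    ∃ (S' : Set (Fin V.n)) (T' : Set (Fin U.n))
      (q : Path (forgetInterfaces Act) H.toIHDA.X (U := ⟨U, S, T'⟩) (V := ⟨V, S', T⟩) x y),
      q.ev = p.ev := by
  induction p with
  | nil x => exact ⟨S, T, .nil _, rfl⟩
  | @up U V _ x y z d hB hx p ih =>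
    let e : Coface U V := d
    -- The newly started events stay out of the pushed-forward source interface, as the condition on
    -- `A` demands; the target interface is pulled back, with no condition since `B` is empty.
    obtain ⟨S', T', q, hq⟩ := ih (e.emb '' S) T
    let d' : ICoface (⟨U, S, e.emb ⁻¹' T'⟩ : ILoSet Act) ⟨V, e.emb '' S, T'⟩ :=
      { toCoface := e
        A_S := by
          rw [Set.disjoint_left]
          rintro _ h ⟨j, -, rfl⟩
          exact e.emb_notMem_A j h
        B_T := by
          have hB' : e.B = ∅ := hB
          rw [hB']
          exact Set.empty_disjoint _
        S_eq := (Set.preimage_image_eq S e.emb.injective).symm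
        T_eq := rfl }
    refine ⟨S', _, Path.up (F := forgetInterfaces Act) d' hB hx q, ?_⟩
    exact congrArg (IPosetArrow.comp (IPosetArrow.starter e)) hq
  | @down U V _ x y z d hA hy p ih =>
    let e : Coface V U := d
    -- Dually, the source interface is restricted and the target interface is pushed into the larger
    -- cell, avoiding the terminated events.
    obtain ⟨S', T', q, hq⟩ := ih (e.emb ⁻¹' S) T
    let d' : ICoface (⟨V, e.emb ⁻¹' S, T'⟩ : ILoSet Act) ⟨U, S, e.emb '' T'⟩ :=
      { toCoface := e
        A_S := by
          have hA' : e.A = ∅ := hA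
          rw [hA']
          exact Set.empty_disjoint _
        B_T := by
          rw [Set.disjoint_left]
          rintro _ h ⟨j, -, rfl⟩
          exact e.emb_notMem_B j h
        S_eq := rfl
        T_eq := (Set.preimage_image_eq T' e.emb.injective).symm }
    refine ⟨S', _, Path.down (F := forgetInterfaces Act) d' hA hy q, ?_⟩
    exact congrArg (IPosetArrow.comp (IPosetArrow.terminator e)) hq

/-- Interfaces can be chosen along any path after prescribing the full source interface at its
beginning and the full target interface at its end, which is all that start and accept cells ask
for. -/
theorem lang_toIHDA (H : HDA Act) : H.toIHDA.lang = H.lang := by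
  ext P
  constructor
  · rintro ⟨U, V, x, y, p, hx, hy, rfl⟩
    obtain ⟨q, hq⟩ := exists_path_of_toIHDA p
    exact ⟨U.toLoSet, V.toLoSet, x, y, q, hx.1, hy.1,
      congrArg (fun a : IPosetArrow U.toLoSet V.toLoSet => Ipomset.mk a.P) hq.symm⟩
  · rintro ⟨U, V, x, y, p, hx, hy, rfl⟩
    obtain ⟨S', T', q, hq⟩ := exists_path_toIHDA p Set.univ Set.univ
    exact ⟨⟨U, Set.univ, T'⟩, ⟨V, S', Set.univ⟩, x, y, q, ⟨hx, rfl⟩, ⟨hy, rfl⟩,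
      congrArg (fun a : IPosetArrow U V => Ipomset.mk a.P) hq.symm⟩

end HDA

/-! ### Regularity of the Kleene plus -/

/-- If `L` is the language of paths in a finite presheaf, then `L⁺` is the language of an HDA. The
language `L` need not be separated: the argument bounds the number of quotients of `L⁺` instead of
gluing accept cells to start cells. -/
theorem recognisedByHDA_kleenePlus {C : Type v} [Category.{w} C] (F : C ⥤ LoSet Act)
    (X : Cᵒᵖ ⥤ Type w') [Finite (Σ U : C, X.obj (op U))]
    (start accept : ∀ U : C, Set (X.obj (op U))) {L : IpomsetLanguage Act}
    (hL : L.carrier = pathLang F X start accept) : L.kleenePlus.RecognisedByHDA := by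
  have hg := (loopGraph F X start accept).finiteQuotients {x | x.2 ∈ start x.1}
    {x | x.2 ∈ accept x.1}
  refine ⟨hg.toHDA, Set.ext fun P => ?_⟩
  induction P using Quotient.ind with
  | _ P => exact (hg.mk_mem_lang_toHDA_iff P).trans (mk_mem_kleenePlus_iff hL P).symm

end HigherDim

/-- A regular language is one that is recognised by an HDA or by an iHDA. If `L` is regular and
separated, then its Kleene plus is regular; indeed it is recognised both by an HDA and by an
iHDA. -/
theorem mainTheorem8 {Act : Type*} (L : HigherDim.IpomsetLanguage Act)
    (hreg : L.RecognisedByHDA ∨ L.RecognisedByIHDA) (hsep : L.IsSeparated) :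
    L.kleenePlus.RecognisedByHDA ∧ L.kleenePlus.RecognisedByIHDA := by
  have h : L.kleenePlus.RecognisedByHDA := by
    rcases hreg with ⟨H, hH⟩ | ⟨H, hH⟩
    · have := H.finite
      exact HigherDim.recognisedByHDA_kleenePlus (𝟭 _) H.X H.start H.accept hH.symm
    · have := H.finite
      exact HigherDim.recognisedByHDA_kleenePlus (HigherDim.forgetInterfaces Act) H.X H.start
        H.accept hH.symm
  refine ⟨h, ?_⟩
  obtain ⟨H, hH⟩ := h
  exact ⟨H.toIHDA, H.lang_toIHDA.trans hH⟩
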